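/- All theories are first-order theories with equality, and $T\vdash\varphi$ means that $\varphi$ is a consequence of $T$ (derivable from $T$; equivalently, true in every nonempty model of $T$ under all assignments). **Definitional equivalence.** A theory $V$ is a *definitional extension* of a theory $U$ if (1) the signature of $V$ extends that of $U$; (2) $V\vdash\varphi\iff U\vdash\varphi$ for all sentences $\varphi$ of the signature of $U$; (3) for each predicate symbol $P$ of $V$ there is a formula $D_P$ of the signature of $U$ with $V\vdash\forall\vec x\,(P(\vec x)\leftrightarrow D_P(\vec x))$; (4) for each function symbol $f$ of $V$ there is a formula $D_f$ of the signature of $U$ with $V\vdash\forall\vec x\,\forall y\,(f(\vec x)=y\leftrightarrow D_f(\vec x,y))$. Two theories are *definitionally equivalent* if, after their symbols have been renamed so that their signatures are disjoint, some theory is a definitional extension of both. **The theory $\mathsf{ZF}^+_{-\mathsf{inf}}$.** It has the signature $\{\in\}$ and the axioms of extensionality, pair, union, power set and regularity, the schemes of separation and replacement, and the axiom that every set is contained in a transitive set. **The relation $\mathsf S$.** Work in $\mathsf{ZF}^+_{-\mathsf{inf}}$. Let $(x,y)=\{\{x\},\{x,y\}\}$ and $(x,y,z)=((x,y),z)$.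 An *$(S,\in)$-structure* is a triple $A=(D,S^A,\in^A)$, where $D$ is a finite set (possibly empty), $S^A\subseteq D^3$ and $\in^A\;\subseteq D^2$, such that $a\in^A b$ implies $S^A(a,b,c)$ for all $a,b,c\in D$. Write $A\lessdot_v B$ if $A,B$ are $(S,\in)$-structures, the domain of $B$ is that of $A$ with exactly one additional element $v$, the relations of $A$ are the restrictions of those of $B$, and $B\models\forall x\,(x\notin v\wedge v\notin x)$. Define ternary relations $\mathsf S_\alpha$ on $V_{6\alpha}$ by transfinite recursion on the ordinal $\alpha$, where $6(\alpha+1)=6\alpha+6$ and $6\lambda=\bigcup_{\alpha<\lambda}6\alpha$ for limit $\lambda$. Put $\mathsf S_0=\emptyset$ and $\mathsf S_\lambda=\bigcup_{\alpha<\lambda}\mathsf S_\alpha$ for limit $\lambda$. Given $\mathsf S_\alpha$, consider all $A\lessdot_v B$ with domains included in $V_{6\alpha}$ such that $a\in b\iff a\in^A b$ for all $a,b$ in the domain of $A$, such that $S^A$ is the restriction of $\mathsf S_\alpha$ to the domain of $A$, and such that $w=(6\alpha+3,(A,B))$ lies in $V_{6\alpha+6}$; let $f_{\alpha,A,B}\colon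 B\to V_{6\alpha+6}$ fix every element of $A$ and map $v$ to $w$. A triple $(x,y,z)$ of elements of $V_{6\alpha+6}$ belongs to $\mathsf S_{\alpha+1}$ if and only if one of the following holds: $x,y,z\in V_{6\alpha}$ and $(x,y,z)\in\mathsf S_\alpha$; or $(x,y,z)=(f_{\alpha,A,B}(a),f_{\alpha,A,B}(b),f_{\alpha,A,B}(c))$ for some such $A,B$ and some $(a,b,c)\in S^B$; or $x,y,z$ are neither all in $V_{6\alpha}$ nor all in the range of one such $f_{\alpha,A,B}$. Let $\mathsf S(x,y,z)$ be the formula of set theory expressing that $(x,y,z)\in\mathsf S_\alpha$ for some ordinal $\alpha$. **The theories $T_1$ and $T_0$.** $T_1$ is the extension of $\mathsf{ZF}^+_{-\mathsf{inf}}$ by a ternary predicate symbol $S$ and the axiom $\forall x,y,z\,(S(x,y,z)\leftrightarrow\mathsf S(x,y,z))$. $T_0$ is the restriction of $T_1$ to the signature $\{S\}$, that is, the set of all sentences of that signature that $T_1$ proves. **Statement.** $T_1\vdash x\in y\leftrightarrow\forall z\,S(x,y,z)$, and the theories $T_0$ and $\mathsf{ZF}^+_{-\mathsf{inf}}$ are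 definitionally equivalent. -/

import Mathlib

open FirstOrder FirstOrder.Language

universe u v

/-! ### Definitional extensions and definitional equivalence

Provability `T ⊢ φ` is Mathlib's consequence relation `T ⊨ᵇ φ` (truth of `φ`, under all assignments
of its free variables, in all nonempty models of `T`). -/

/-- `T` is a definitional extension of `U` along the inclusion `ι` of signatures. -/
structure IsDefinitionalExtension {L L' : FirstOrder.Language.{u, v}} (ι : L →ᴸ L')
    (U : L.Theory) (T : L'.Theory) : Prop where
  /-- The signature of `T` extends the signature of `U`. -/
  injective : ι.Injective
  /-- `T` and `U` prove the same sentences of the signature of `U`. -/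
  conservative : ∀ φ : L.Sentence, T ⊨ᵇ ι.onSentence φ ↔ U ⊨ᵇ φ
  /-- Each predicate symbol of `T` has a definition by a formula of the signature of `U`. -/
  relation_def : ∀ (n : ℕ) (P : L'.Relations n), ∃ D : L.Formula (Fin n),
    T ⊨ᵇ (P.formula fun i => Term.var i).iff (ι.onFormula D)
  /-- Each function symbol of `T` has a definition by a formula of the signature of `U`;
  in `D`, the variable `0` is the value and the variables `1, …, n` are the arguments. -/
  function_def : ∀ (n : ℕ) (f : L'.Functions n), ∃ D : L.Formula (Fin (n + 1)),
    T ⊨ᵇ (Formula.graph f).iff (ι.onFormula D)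

/-- Two theories are definitionally equivalent if, after their signatures have been made disjoint
by renaming, some theory is a definitional extension of both. The renaming is carried out by the
embeddings `ι₁` and `ι₂`, whose images are disjoint. -/
def DefinitionallyEquivalent {L₁ L₂ : FirstOrder.Language.{u, v}} (T : L₁.Theory) (U : L₂.Theory) : Prop :=
  ∃ (L : FirstOrder.Language.{u, v}) (ι₁ : L₁ →ᴸ L) (ι₂ : L₂ →ᴸ L) (V : L.Theory),
    (∀ (n : ℕ) (f : L₁.Functions n) (g : L₂.Functions n), ι₁.onFunction f ≠ ι₂.onFunction g) ∧
    (∀ (n : ℕ) (P : L₁.Relations n) (Q : L₂.Relations n), ι₁.onRelation P ≠ ι₂.onRelation Q) ∧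
    IsDefinitionalExtension ι₁ T V ∧ IsDefinitionalExtension ι₂ U V

/-! ### The signatures -/

/-- The only symbol of the signature of set theory: a binary predicate. -/
inductive MemSymbol : ℕ → Type
  | mem : MemSymbol 2

/-- The signature `{∈}`. -/
def memLang : FirstOrder.Language.{0, 0} := ⟨fun _ => Empty, MemSymbol⟩

/-- The predicate symbol `∈`. -/
def memSymbol : memLang.Relations 2 := MemSymbol.mem

/-- The only symbol of the signature of `T₀`: a ternary predicate. -/
inductive TernarySymbol : ℕ → Type
  | S : TernarySymbol 3

/-- The signature `{S}`. -/
def ternaryLang : FirstOrder.Language.{0, 0} := ⟨fun _ => Empty, TernarySymbol⟩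

/-- The predicate symbol `S`. -/
def ternarySymbol : ternaryLang.Relations 3 := TernarySymbol.S

/-- The signature `{∈, S}`. -/
abbrev bothLang : FirstOrder.Language.{0, 0} := memLang.sum ternaryLang

namespace SetFormula

/-! ### Writing formulas of set theory

`Fml n` is the type of formulas in `{∈}` with the variables `0, …, n - 1`. The quantifiers
`all fun x => φ` and `ex fun x => φ` bind the new variable `n`. The variables of the outer context
are carried into the scope of a quantifier by `Fin.castSucc`, inserted as a coercion. -/

/-- Formulas in `{∈}` with variables `0, …, n - 1`. -/
abbrev Fml (n : ℕ) : Type := memLang.BoundedFormula Empty n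

section

/-- A variable of a context is also a variable of the context with one more variable. -/
abbrev liftVar (n : ℕ) : Coe (Fin n) (Fin (n + 1)) := ⟨Fin.castSucc⟩

attribute [local instance] liftVar

variable {n : ℕ}

def mem (x y : Fin n) : Fml n :=
  memSymbol.boundedFormula₂ (Term.var (Sum.inr x)) (Term.var (Sum.inr y))
def eq (x y : Fin n) : Fml n := Term.bdEqual (Term.var (Sum.inr x)) (Term.var (Sum.inr y))
def neg (φ : Fml n) : Fml n := BoundedFormula.not φ
def and (φ ψ : Fml n) : Fml n := φ ⊓ ψ
def or (φ ψ : Fml n) : Fml n := φ ⊔ ψ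
def imp (φ ψ : Fml n) : Fml n := BoundedFormula.imp φ ψ
def iff (φ ψ : Fml n) : Fml n := BoundedFormula.iff φ ψ
def all (φ : Fin (n + 1) → Fml (n + 1)) : Fml n := BoundedFormula.all (φ (Fin.last n))
def ex (φ : Fin (n + 1) → Fml (n + 1)) : Fml n := BoundedFormula.ex (φ (Fin.last n))

local infix:70 " ∈₀ " => mem
local infix:70 " ≐ " => eq
local prefix:75 "¬₀" => neg
local infixr:65 " ∧₀ " => and
local infixr:64 " ∨₀ " => or
local infixr:63 " →₀ " => imp
local infix:62 " ↔₀ " => iff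

/-! ### The theory `ZF` without infinity and with transitive closures -/

/-- `x ⊆ y`. -/
def sub (x y : Fin n) : Fml n := all fun z => z ∈₀ x →₀ z ∈₀ y

/-- `x` is a transitive set. -/
def trans (x : Fin n) : Fml n := all fun y => y ∈₀ x →₀ sub y x

def extensionality : memLang.Sentence :=
  all fun x => all fun y => (all fun z => z ∈₀ x ↔₀ z ∈₀ y) →₀ x ≐ y

def pairing : memLang.Sentence :=
  all fun x => all fun y => ex fun p => all fun z => z ∈₀ p ↔₀ (z ≐ x ∨₀ z ≐ y)

def union : memLang.Sentence :=
  all fun x => ex fun u => all fun z => z ∈₀ u ↔₀ ex fun y => y ∈₀ x ∧₀ z ∈₀ y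

def powerSet : memLang.Sentence :=
  all fun x => ex fun p => all fun z => z ∈₀ p ↔₀ sub z x

def regularity : memLang.Sentence :=
  all fun x => (ex fun y => y ∈₀ x) →₀ ex fun y => y ∈₀ x ∧₀ ¬₀ ex fun z => z ∈₀ y ∧₀ z ∈₀ x

/-- `φ(p₀, …, p_{k-1}, y₀, …, y_{m-1})`, where the parameters `p` and the arguments `y` of `φ` are
replaced by the given variables. -/
def inst {k m : ℕ} (φ : memLang.Formula (Fin k ⊕ Fin m)) (p : Fin k → Fin n) (y : Fin m → Fin n) :
    Fml n :=
  BoundedFormula.relabel (n := n) (k := 0) (fun i => Sum.inr (Sum.elim p y i)) φ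

/-- Separation for `φ(p, x)`: `∀ p ∀ a ∃ b ∀ x (x ∈ b ↔ x ∈ a ∧ φ(p, x))`. -/
def separation {k : ℕ} (φ : memLang.Formula (Fin k ⊕ Fin 1)) : memLang.Sentence :=
  BoundedFormula.alls (n := k) (all fun a => ex fun b => all fun x =>
    x ∈₀ b ↔₀ (x ∈₀ a ∧₀ inst φ (Fin.castAdd 3) ![x]))

/-- Replacement for `φ(p, x, y)`: for all `p` and `a`, if for each `x ∈ a` there is at most one `y`
with `φ(p, x, y)`, then the `y` with `φ(p, x, y)` for some `x ∈ a` form a set. -/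
def replacement {k : ℕ} (φ : memLang.Formula (Fin k ⊕ Fin 2)) : memLang.Sentence :=
  BoundedFormula.alls (n := k) (all fun a =>
    (all fun x => x ∈₀ a →₀ all fun y => all fun z =>
      (inst φ (Fin.castAdd 4) ![x, y] ∧₀ inst φ (Fin.castAdd 4) ![x, z]) →₀ y ≐ z) →₀
    ex fun b => all fun y => y ∈₀ b ↔₀ ex fun x => x ∈₀ a ∧₀ inst φ (Fin.castAdd 4) ![x, y])

/-- Each set is contained in a transitive set. -/
def transitiveClosure : memLang.Sentence :=
  all fun x => ex fun t => sub x t ∧₀ trans t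

/-! ### Basic set-theoretic notions -/

/-- `x = ∅`. -/
def isEmpty (x : Fin n) : Fml n := all fun z => ¬₀ (z ∈₀ x)

/-- `y = x ∪ {x}`. -/
def isSucc (y x : Fin n) : Fml n := all fun z => z ∈₀ y ↔₀ (z ∈₀ x ∨₀ z ≐ x)

/-- `p` is the power set of `x`. -/
def isPow (p x : Fin n) : Fml n := all fun z => z ∈₀ p ↔₀ sub z x

/-- `p = {a, b}`. -/
def isUPair (p a b : Fin n) : Fml n := all fun z => z ∈₀ p ↔₀ (z ≐ a ∨₀ z ≐ b)

/-- `p` is the Kuratowski pair `(a, b) = {{a}, {a, b}}`. -/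
def isPair (p a b : Fin n) : Fml n :=
  ex fun s => ex fun d => isUPair s a a ∧₀ isUPair d a b ∧₀ isUPair p s d

/-- `t` is the triple `(a, b, c) = ((a, b), c)`. -/
def isTriple (t a b c : Fin n) : Fml n := ex fun p => isPair p a b ∧₀ isPair t p c

/-- `(a, b) ∈ r`. -/
def pairMem (r a b : Fin n) : Fml n := ex fun p => isPair p a b ∧₀ p ∈₀ r

/-- `(a, b, c) ∈ r`. -/
def tripleMem (r a b c : Fin n) : Fml n := ex fun t => isTriple t a b c ∧₀ t ∈₀ r

/-- `f` is a function with domain `d`. -/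
def isFunOn (f d : Fin n) : Fml n :=
  (all fun p => p ∈₀ f →₀ ex fun x => ex fun y => x ∈₀ d ∧₀ isPair p x y) ∧₀
  (all fun x => x ∈₀ d →₀ ex fun y => pairMem f x y ∧₀ all fun z => pairMem f x z →₀ z ≐ y)

/-- `x` is an ordinal: a transitive set of transitive sets. -/
def isOrd (x : Fin n) : Fml n := trans x ∧₀ all fun y => y ∈₀ x →₀ trans y

/-- The ordinal `x` is a limit: neither zero nor a successor. -/
def isLimit (x : Fin n) : Fml n := isOrd x ∧₀ ¬₀ isEmpty x ∧₀ ¬₀ ex fun y => isSucc x y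

/-- `x` is a natural number: an ordinal such that it and all its elements are zero or successors. -/
def isNat (x : Fin n) : Fml n :=
  isOrd x ∧₀ all fun y => (y ∈₀ x ∨₀ y ≐ x) →₀ (isEmpty y ∨₀ ex fun z => isSucc y z)

/-- `x` is finite: it is the bijective image of a natural number. -/
def isFinite (x : Fin n) : Fml n :=
  ex fun k => ex fun g => isNat k ∧₀ isFunOn g k ∧₀
    (all fun y => y ∈₀ x ↔₀ ex fun i => pairMem g i y) ∧₀
    (all fun i => all fun j => all fun y => (pairMem g i y ∧₀ pairMem g j y) →₀ i ≐ j)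

/-! ### Transfinite recursion -/

/-- `y = F(α)`, where `F` is defined by transfinite recursion: `F(0) = ∅`,
`step β F(β) F(β + 1)` holds, and `F(γ) = ⋃_{β < γ} F(β)` for limit `γ`. The variable `f` is the
restriction of `F` to `d = α + 1`. -/
def isRec (step : ∀ {m : ℕ}, Fin m → Fin m → Fin m → Fml m) (α y : Fin n) : Fml n :=
  isOrd α ∧₀ ex fun d => ex fun f => isSucc d α ∧₀ isFunOn f d ∧₀
    (all fun z => isEmpty z →₀ pairMem f z z) ∧₀
    (all fun β => all fun β' => all fun u => all fun u' =>
      (β ∈₀ α ∧₀ isSucc β' β ∧₀ pairMem f β u ∧₀ pairMem f β' u') →₀ step β u u') ∧₀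
    (all fun γ => all fun u => (γ ∈₀ d ∧₀ isLimit γ ∧₀ pairMem f γ u) →₀
      all fun t => t ∈₀ u ↔₀ ex fun β => ex fun w => β ∈₀ γ ∧₀ pairMem f β w ∧₀ t ∈₀ w) ∧₀
    pairMem f α y

/-- `y = x + 3` for ordinals. -/
def isAddThree (y x : Fin n) : Fml n :=
  ex fun a => ex fun b => isSucc a x ∧₀ isSucc b a ∧₀ isSucc y b

/-- `y = x + 6` for ordinals. -/
def isAddSix (y x : Fin n) : Fml n := ex fun a => isAddThree a x ∧₀ isAddThree y a

/-- `y = 6α`, where `6(α + 1) = 6α + 6`. -/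
def isSixTimes (y α : Fin n) : Fml n := isRec (fun _ u u' => isAddSix u' u) α y

/-- `w` is the level `V_α` of the von Neumann hierarchy. -/
def isLevel (w α : Fin n) : Fml n := isRec (fun _ u u' => isPow u' u) α w

/-! ### The ternary relation -/

/-- `A = (D, R, E)` is an `(S, ∈)`-structure: a finite structure with domain `D`, a ternary relation
`R` (the interpretation of `S`) and a binary relation `E` (the interpretation of `∈`), such that
`(a, b) ∈ E` implies `(a, b, c) ∈ R` for all `a, b, c ∈ D`. -/
def isStr (A D R E : Fin n) : Fml n :=
  isTriple A D R E ∧₀ isFinite D ∧₀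
  (all fun t => t ∈₀ R →₀ ex fun a => ex fun b => ex fun c =>
    a ∈₀ D ∧₀ b ∈₀ D ∧₀ c ∈₀ D ∧₀ isTriple t a b c) ∧₀
  (all fun p => p ∈₀ E →₀ ex fun a => ex fun b => a ∈₀ D ∧₀ b ∈₀ D ∧₀ isPair p a b) ∧₀
  (all fun a => all fun b => all fun c =>
    (a ∈₀ D ∧₀ b ∈₀ D ∧₀ c ∈₀ D ∧₀ pairMem E a b) →₀ tripleMem R a b c)

/-- `(D', R', E')` neutrally extends `(D, R, E)` by the element `v`. -/
def isNeutralExt (D R E D' R' E' v : Fin n) : Fml n :=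
  ¬₀ (v ∈₀ D) ∧₀ (all fun x => x ∈₀ D' ↔₀ (x ∈₀ D ∨₀ x ≐ v)) ∧₀
  (all fun a => all fun b => all fun c => (a ∈₀ D ∧₀ b ∈₀ D ∧₀ c ∈₀ D) →₀
    (tripleMem R a b c ↔₀ tripleMem R' a b c)) ∧₀
  (all fun a => all fun b => (a ∈₀ D ∧₀ b ∈₀ D) →₀ (pairMem E a b ↔₀ pairMem E' a b)) ∧₀
  (all fun x => x ∈₀ D' →₀ (¬₀ pairMem E' x v ∧₀ ¬₀ pairMem E' v x))

/-- Given `m = 6α`, `W = V_{6α}`, `W' = V_{6α+6}` and `s = S_α`: the sets `D` and `D' = D ∪ {v}` are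
the domains of `(S, ∈)`-structures `A`, `B` with `A ⋖_v B` and `D' ⊆ W`, such that `A` is
`∈`-absolute and its interpretation of `S` is the restriction of `s`; `R'` is the interpretation of
`S` in `B`; and `w = (6α + 3, (A, B))` is the image of `v` under the map `f_{α,A,B} : B → W'`. -/
def isAdmissible (m W W' s D D' R' v w : Fin n) : Fml n :=
  ex fun A => ex fun B => ex fun R => ex fun E => ex fun E' =>
    isStr A D R E ∧₀ isStr B D' R' E' ∧₀ isNeutralExt D R E D' R' E' v ∧₀ sub D' W ∧₀
    (all fun a => all fun b => (a ∈₀ D ∧₀ b ∈₀ D) →₀ (a ∈₀ b ↔₀ pairMem E a b)) ∧₀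
    (all fun a => all fun b => all fun c => (a ∈₀ D ∧₀ b ∈₀ D ∧₀ c ∈₀ D) →₀
      (tripleMem R a b c ↔₀ tripleMem s a b c)) ∧₀
    (ex fun o => ex fun q => isAddThree o m ∧₀ isPair q A B ∧₀ isPair w o q) ∧₀ w ∈₀ W'

/-- `f(a) = x` for the map `f : D ∪ {v} → D ∪ {w}` that fixes `D` and maps `v` to `w`. -/
def isImage (D v w a x : Fin n) : Fml n := (a ∈₀ D ∧₀ x ≐ a) ∨₀ (a ≐ v ∧₀ x ≐ w)

/-- `s' = S_{α+1}` is obtained from `s = S_α`. A triple of elements of `V_{6α+6}` belongs to `s'` iff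
it is a triple of elements of `V_{6α}` that belongs to `s`, or it is the image under some
`f_{α,A,B}` of a triple in the interpretation of `S` in `B`, or it is neither a triple of elements of
`V_{6α}` nor a triple of elements of the range of some `f_{α,A,B}`. -/
def isStep (α s s' : Fin n) : Fml n :=
  ex fun m => ex fun m' => ex fun W => ex fun W' =>
    isSixTimes m α ∧₀ isAddSix m' m ∧₀ isLevel W m ∧₀ isLevel W' m' ∧₀
    all fun t => t ∈₀ s' ↔₀ ex fun x => ex fun y => ex fun z =>
      x ∈₀ W' ∧₀ y ∈₀ W' ∧₀ z ∈₀ W' ∧₀ isTriple t x y z ∧₀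
      ( (x ∈₀ W ∧₀ y ∈₀ W ∧₀ z ∈₀ W ∧₀ t ∈₀ s) ∨₀
        (ex fun D => ex fun D' => ex fun R' => ex fun v => ex fun w =>
          isAdmissible m W W' s D D' R' v w ∧₀
          ex fun a => ex fun b => ex fun c =>
            isImage D v w a x ∧₀ isImage D v w b y ∧₀ isImage D v w c z ∧₀ tripleMem R' a b c) ∨₀
        (¬₀ (x ∈₀ W ∧₀ y ∈₀ W ∧₀ z ∈₀ W) ∧₀
          ¬₀ ex fun D => ex fun D' => ex fun R' => ex fun v => ex fun w =>
            isAdmissible m W W' s D D' R' v w ∧₀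
            (x ∈₀ D ∨₀ x ≐ w) ∧₀ (y ∈₀ D ∨₀ y ≐ w) ∧₀ (z ∈₀ D ∨₀ z ≐ w)) )

/-- `(a, b, c) ∈ S_α` for some ordinal `α`. -/
def ternary (a b c : Fin n) : Fml n :=
  ex fun α => ex fun s => isRec isStep α s ∧₀ tripleMem s a b c

end

end SetFormula

/-- The axioms of `ZF` without the axiom of infinity and with the axiom of transitive closure. -/
inductive ZFMinusInfPlusAxiom : memLang.Sentence → Prop
  | extensionality : ZFMinusInfPlusAxiom SetFormula.extensionality
  | pairing : ZFMinusInfPlusAxiom SetFormula.pairing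
  | union : ZFMinusInfPlusAxiom SetFormula.union
  | powerSet : ZFMinusInfPlusAxiom SetFormula.powerSet
  | regularity : ZFMinusInfPlusAxiom SetFormula.regularity
  | separation {k : ℕ} (φ : memLang.Formula (Fin k ⊕ Fin 1)) :
      ZFMinusInfPlusAxiom (SetFormula.separation φ)
  | replacement {k : ℕ} (φ : memLang.Formula (Fin k ⊕ Fin 2)) :
      ZFMinusInfPlusAxiom (SetFormula.replacement φ)
  | transitiveClosure : ZFMinusInfPlusAxiom SetFormula.transitiveClosure

/-- `ZF` without the axiom of infinity and with the axiom of transitive closure. -/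
def ZFMinusInfPlus : memLang.Theory := {φ | ZFMinusInfPlusAxiom φ}

/-- The atomic formula `S(x, y, z)` of the signature `{∈, S}`. -/
def ternaryAtom {n : ℕ} (x y z : Fin n) : bothLang.BoundedFormula Empty n :=
  Relations.boundedFormula (L := bothLang) (LHom.sumInr.onRelation ternarySymbol)
    ![Term.var (Sum.inr x), Term.var (Sum.inr y), Term.var (Sum.inr z)]

/-- The atomic formula `x ∈ y` of the signature `{∈, S}`. -/
def memAtom {n : ℕ} (x y : Fin n) : bothLang.BoundedFormula Empty n :=
  Relations.boundedFormula (L := bothLang) (LHom.sumInl.onRelation memSymbol)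
    ![Term.var (Sum.inr x), Term.var (Sum.inr y)]

/-- The defining axiom of `S`: the universal closure of `S(x, y, z) ↔ 𝖲(x, y, z)`. -/
def ternaryDefinition : bothLang.Sentence :=
  BoundedFormula.alls (n := 3) (BoundedFormula.iff (ternaryAtom 0 1 2)
    (LHom.sumInl.onBoundedFormula (SetFormula.ternary 0 1 2)))

/-- `T₁`: the extension of `ZFMinusInfPlus` by the predicate `S` with its defining axiom. -/
def T₁ : bothLang.Theory := LHom.sumInl.onTheory ZFMinusInfPlus ∪ {ternaryDefinition}

/-- `T₀`: the restriction of `T₁` to the signature `{S}`, that is, the set of all sentences of that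
signature that `T₁` proves. -/
def T₀ : ternaryLang.Theory := {φ | T₁ ⊨ᵇ LHom.sumInr.onSentence φ}

/-! The substance is the equivalence of `x ∈ y` with `∀ z, S(x, y, z)`, proved inside an arbitrary
model `M` of the set theory.

Suppose `x ∈ y`. By induction on `α`, `S_α` contains `(x, y, z)` whenever the three entries lie in
`V_{6α}` (`triple_mem_levelS_of_mem`). At a successor, a new triple that lies in the range of no map
`f_{α,A,B}` enters by default. If it lies in such a range, then `x` and `y` belong to `A`: the new
point `w = (6α + 3, (A, B))` has too high a rank to belong to a set in `V_{6α}`, and all its members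
have too high a rank to lie in `V_{6α}`. The condition that `a ∈^B b` implies `S^B(a, b, c)` then
puts the triple into `S_{α+1}`.

Suppose `x ∉ y`. Let `A` be the structure induced on `{x, y}`, and add a point `v` for which `S^B(a,
b, v)` holds exactly when `a ∈ b`, with no other triple through `v`. At a suitable level this
extension is admissible (`exists_admissible`). The point `w` encodes `A` and `B`, so no other
extension decides a triple through `w` (`Admissible.unique`), and `(x, y, w)` is left out of
`S_{α+1}`. The relations `S_α` agree on common domains (`levelS_coherent`), hence `S(x, y, w)`
fails.

The common definitional extension is `T₁` itself: `S` is defined from `∈` by its axiom, and `∈` from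
`S` by the equivalence. Conservativity over set theory holds because every model expands to a model
of `T₁`; over `T₀` it is built into the definition.

Separation and replacement are schemes, so every predicate they are applied to must come from a
formula. The classes `DefPred` and `DefFun` are closed under connectives, quantifiers and
substitution, which lets instance search supply these formulas. The `realize_` lemmas match the
official formulas with the predicates used in the argument. -/

/-! ### Definable predicates and functions on a model of set theory -/

namespace SetModel

variable {M : Type} [memLang.Structure M] {ι κ : Type}

/-- Membership in a structure for the signature `{∈}`. -/
def E (a b : M) : Prop := Structure.RelMap memSymbol ![a, b]

infix:50 " ε " => E

/-- The predicate `P` is definable with parameters. -/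
class DefPred (P : (ι → M) → Prop) : Prop where
  out : ∃ φ : memLang.Formula (M ⊕ ι), ∀ v, φ.Realize (Sum.elim id v) ↔ P v

/-- The function `t` is definable with parameters: its graph is a definable predicate. -/
class DefFun (t : (ι → M) → M) : Prop where
  out : DefPred fun v : Option ι → M => v none = t fun i => v (some i)

theorem DefPred.congr {P Q : (ι → M) → Prop} (hP : DefPred P) (h : ∀ v, Q v ↔ P v) :
    DefPred Q := by
  obtain ⟨φ, hφ⟩ := hP.out
  exact ⟨φ, fun v => (hφ v).trans (h v).symm⟩

instance DefPred.const (p : Prop) : DefPred fun _ : ι → M => p := by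
  by_cases h : p
  · exact ⟨⊤, fun v => by simp [h]⟩
  · exact ⟨⊥, fun v => by simp [h]⟩

instance DefPred.not (P : (ι → M) → Prop) [hP : DefPred P] : DefPred fun v => ¬ P v := by
  obtain ⟨φ, hφ⟩ := hP.out
  exact ⟨φ.not, fun v => by simp [hφ]⟩

instance DefPred.imp (P Q : (ι → M) → Prop) [hP : DefPred P] [hQ : DefPred Q] :
    DefPred fun v => P v → Q v := by
  obtain ⟨φ, hφ⟩ := hP.out
  obtain ⟨ψ, hψ⟩ := hQ.out
  exact ⟨φ.imp ψ, fun v => by simp [hφ, hψ]⟩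

instance DefPred.and (P Q : (ι → M) → Prop) [hP : DefPred P] [hQ : DefPred Q] :
    DefPred fun v => P v ∧ Q v := by
  obtain ⟨φ, hφ⟩ := hP.out
  obtain ⟨ψ, hψ⟩ := hQ.out
  exact ⟨φ ⊓ ψ, fun v => by simp [hφ, hψ]⟩

instance DefPred.or (P Q : (ι → M) → Prop) [hP : DefPred P] [hQ : DefPred Q] :
    DefPred fun v => P v ∨ Q v := by
  obtain ⟨φ, hφ⟩ := hP.out
  obtain ⟨ψ, hψ⟩ := hQ.out
  exact ⟨φ ⊔ ψ, fun v => by simp [hφ, hψ]⟩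

instance DefPred.iff (P Q : (ι → M) → Prop) [hP : DefPred P] [hQ : DefPred Q] :
    DefPred fun v => P v ↔ Q v := by
  obtain ⟨φ, hφ⟩ := hP.out
  obtain ⟨ψ, hψ⟩ := hQ.out
  exact ⟨φ.iff ψ, fun v => by simp [hφ, hψ]⟩

/-- A variable may be sent to a variable or to an element of `M`, so renaming, weakening and the
fixing of parameters are all instances. -/
theorem DefPred.comap {P : (ι → M) → Prop} (hP : DefPred P) (f : ι → M ⊕ κ) :
    DefPred fun v : κ → M => P fun i => Sum.elim id v (f i) := by
  obtain ⟨φ, hφ⟩ := hP.out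
  refine ⟨φ.relabel (Sum.elim Sum.inl f), fun v => ?_⟩
  rw [Formula.realize_relabel, ← hφ]
  refine iff_of_eq (congrArg _ (funext fun i => ?_))
  rcases i with i | i <;> rfl

theorem DefPred.exists_finite {P : (κ → M) → (ι → M) → Prop} [Finite κ]
    (hP : DefPred fun v : ι ⊕ κ → M => P (fun i => v (Sum.inr i)) fun i => v (Sum.inl i)) :
    DefPred fun v : ι → M => ∃ w, P w v := by
  obtain ⟨φ, hφ⟩ := hP.out
  refine ⟨Formula.iExs κ (φ.relabel (Equiv.sumAssoc M ι κ).symm), fun v => ?_⟩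
  rw [Formula.realize_iExs]
  refine exists_congr fun w => ?_
  rw [Formula.realize_relabel]
  refine Iff.trans (iff_of_eq (congrArg _ (funext fun i => ?_))) (hφ (Sum.elim v w))
  rcases i with i | i | i <;> rfl

/-- The bound variable is the new point `none` of `Option ι`. In this form instance search can pass
under binders. -/
instance DefPred.ex (P : (ι → M) → M → Prop)
    [hP : DefPred fun v : Option ι → M => P (fun i => v (some i)) (v none)] :
    DefPred fun v => ∃ x, P v x := by
  have h := hP.comap (κ := ι ⊕ Unit) (fun i => Sum.inr (i.elim (Sum.inr ()) Sum.inl))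
  have := DefPred.exists_finite (P := fun w v => P v (w ())) h
  exact this.congr fun v => ⟨fun ⟨x, hx⟩ => ⟨fun _ => x, hx⟩, fun ⟨w, hw⟩ => ⟨w (), hw⟩⟩

instance DefPred.all (P : (ι → M) → M → Prop)
    [hP : DefPred fun v : Option ι → M => P (fun i => v (some i)) (v none)] :
    DefPred fun v => ∀ x, P v x := by
  have : DefPred fun v : ι → M => ¬ ∃ x, ¬ P v x := inferInstance
  exact this.congr fun v => by simp

theorem DefPred.eq_term (s t : M ⊕ ι) :
    DefPred fun v : ι → M => Sum.elim id v s = Sum.elim id v t :=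
  ⟨Term.equal (Term.var s) (Term.var t), fun v => by simp⟩

theorem DefPred.mem_term (s t : M ⊕ ι) :
    DefPred fun v : ι → M => Sum.elim id v s ε Sum.elim id v t :=
  ⟨memSymbol.formula₂ (Term.var s) (Term.var t), fun v => by
    simp [Formula.realize_rel₂, E]⟩

instance DefFun.proj (i : ι) : DefFun fun v : ι → M => v i :=
  ⟨DefPred.eq_term (Sum.inr none) (Sum.inr (some i))⟩

instance DefFun.const (c : M) : DefFun fun _ : ι → M => c :=
  ⟨DefPred.eq_term (Sum.inr none) (Sum.inl c)⟩

theorem DefPred.forall_finite {P : κ → (ι → M) → Prop} [Finite κ] (hP : ∀ k, DefPred (P k)) :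
    DefPred fun v : ι → M => ∀ k, P k v := by
  choose φ hφ using fun k => (hP k).out
  exact ⟨Formula.iInf φ, fun v => by simp [hφ]⟩

/-- Definable functions are not terms of the language. They are eliminated through their graphs:
`P(t(v))` says that some tuple `w` has `w k = t k v` for all `k` and satisfies `P`. -/
theorem DefPred.subst {P : (κ → M) → Prop} [Finite κ] (hP : DefPred P) (t : κ → (ι → M) → M)
    (ht : ∀ k, DefFun (t k)) : DefPred fun v => P fun k => t k v := by
  have h₁ : DefPred fun v : ι ⊕ κ → M => ∀ k, v (Sum.inr k) = t k fun i => v (Sum.inl i) :=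
    DefPred.forall_finite fun k =>
      (ht k).out.comap (fun i => Sum.inr (i.elim (Sum.inr k) Sum.inl))
  have h₂ : DefPred fun v : ι ⊕ κ → M => P fun k => v (Sum.inr k) :=
    hP.comap (fun k => Sum.inr (Sum.inr k))
  have := DefPred.exists_finite
    (P := fun (w : κ → M) (v : ι → M) => (∀ k, w k = t k v) ∧ P w) inferInstance
  refine this.congr fun v => ⟨fun h => ⟨_, fun _ => rfl, h⟩, fun ⟨w, hw, h⟩ => ?_⟩
  rwa [← funext hw]

theorem DefFun.comap {t : (ι → M) → M} (ht : DefFun t) (f : ι → κ) :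
    DefFun fun v : κ → M => t fun i => v (f i) :=
  ⟨ht.out.comap fun i => Sum.inr (i.map f)⟩

instance DefPred.mem (s t : (ι → M) → M) [hs : DefFun s] [ht : DefFun t] :
    DefPred fun v => s v ε t v :=
  DefPred.subst (P := fun w : Fin 2 → M => w 0 ε w 1)
    (DefPred.mem_term (Sum.inr 0) (Sum.inr 1)) ![s, t] (by simp [Fin.forall_fin_two, hs, ht])

instance DefPred.eq (s t : (ι → M) → M) [hs : DefFun s] [ht : DefFun t] :
    DefPred fun v => s v = t v :=
  DefPred.subst (P := fun w : Fin 2 → M => w 0 = w 1)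
    (DefPred.eq_term (Sum.inr 0) (Sum.inr 1)) ![s, t] (by simp [Fin.forall_fin_two, hs, ht])

theorem DefPred.subst₁ {P : M → Prop} (hP : DefPred fun w : Fin 1 → M => P (w 0))
    (s : (ι → M) → M) [hs : DefFun s] : DefPred fun v => P (s v) :=
  hP.subst ![s] (by simp [hs])

theorem DefPred.subst₂ {P : M → M → Prop} (hP : DefPred fun w : Fin 2 → M => P (w 0) (w 1))
    (s t : (ι → M) → M) [hs : DefFun s] [ht : DefFun t] : DefPred fun v => P (s v) (t v) :=
  hP.subst ![s, t] (by simp [Fin.forall_fin_two, hs, ht])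

theorem DefPred.subst₃ {P : M → M → M → Prop}
    (hP : DefPred fun w : Fin 3 → M => P (w 0) (w 1) (w 2))
    (s t r : (ι → M) → M) [hs : DefFun s] [ht : DefFun t] [hr : DefFun r] :
    DefPred fun v => P (s v) (t v) (r v) :=
  hP.subst ![s, t, r] (by simp [Fin.forall_fin_succ, hs, ht, hr])

theorem DefPred.subst₄ {P : M → M → M → M → Prop}
    (hP : DefPred fun w : Fin 4 → M => P (w 0) (w 1) (w 2) (w 3))
    (s t r q : (ι → M) → M) [hs : DefFun s] [ht : DefFun t] [hr : DefFun r] [hq : DefFun q] :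
    DefPred fun v => P (s v) (t v) (r v) (q v) :=
  hP.subst ![s, t, r, q] (by simp [Fin.forall_fin_succ, hs, ht, hr, hq])

theorem DefFun.subst₁ {F : M → M} (hF : DefPred fun w : Fin 2 → M => w 0 = F (w 1))
    (s : (ι → M) → M) [hs : DefFun s] : DefFun fun v => F (s v) :=
  have := hs.comap (κ := Option ι) some
  ⟨hF.subst₂ (P := fun y a => y = F a) _ _⟩

theorem DefFun.subst₂ {F : M → M → M} (hF : DefPred fun w : Fin 3 → M => w 0 = F (w 1) (w 2))
    (s t : (ι → M) → M) [hs : DefFun s] [ht : DefFun t] : DefFun fun v => F (s v) (t v) :=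
  have := hs.comap (κ := Option ι) some
  have := ht.comap (κ := Option ι) some
  ⟨hF.subst₃ (P := fun y a b => y = F a b) _ _ _⟩

theorem DefFun.apply₂ {G : M → M → M} [hG : DefFun fun w : Fin 2 → M => G (w 0) (w 1)]
    (s t : (ι → M) → M) [DefFun s] [DefFun t] :
    DefFun fun v => G (s v) (t v) :=
  .subst₂ (hG.out.comap (κ := Fin 3) fun i => Sum.inr (i.elim 0 ![1, 2])) s t

/-- Fixing all variables but the last one of a definable predicate. -/
theorem DefPred.fix {P : (ι → M) → M → Prop}
    (hP : DefPred fun v : Option ι → M => P (fun i => v (some i)) (v none)) (v : ι → M) :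
    DefPred fun w : Unit → M => P v (w ()) :=
  hP.comap fun i => i.elim (Sum.inr ()) fun i => Sum.inl (v i)

/-- A definable predicate is given by a formula with finitely many parameters. -/
theorem DefPred.exists_params {P : (ι → M) → Prop} [hP : DefPred P] :
    ∃ (k : ℕ) (φ : memLang.Formula (Fin k ⊕ ι)) (p : Fin k → M),
      ∀ v, φ.Realize (Sum.elim p v) ↔ P v := by
  classical
  obtain ⟨φ, hφ⟩ := hP.out
  -- The parameters needed are the elements of `M` that occur free in the formula.
  let s : Finset M := φ.freeVarFinset.toLeft
  let e := s.equivFin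
  refine ⟨s.card, φ.restrictFreeVar fun x => match x with
    | ⟨Sum.inl m, h⟩ => Sum.inl (e ⟨m, by simpa [s] using h⟩)
    | ⟨Sum.inr i, _⟩ => Sum.inr i, fun i => (e.symm i : M), fun v => ?_⟩
  rw [← hφ]
  refine BoundedFormula.realize_restrictFreeVar _ ?_
  rintro ⟨m | i, h⟩ <;> simp

end SetModel

/-! ### Elementary set theory in a model -/

/-- `M` satisfies extensionality, pair, union, power set, regularity, the existence of transitive
supersets, and separation and replacement for predicates definable with parameters. -/
class SetModel (M : Type) [memLang.Structure M] : Prop where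
  ext : ∀ x y : M, (∀ z, SetModel.E z x ↔ SetModel.E z y) → x = y
  pairing : ∀ a b : M, ∃ p, ∀ z, SetModel.E z p ↔ z = a ∨ z = b
  union : ∀ a : M, ∃ u, ∀ z, SetModel.E z u ↔ ∃ y, SetModel.E y a ∧ SetModel.E z y
  powerSet : ∀ a : M, ∃ p, ∀ z, SetModel.E z p ↔ ∀ t, SetModel.E t z → SetModel.E t a
  regularity : ∀ x : M, (∃ y, SetModel.E y x) →
    ∃ y, SetModel.E y x ∧ ¬ ∃ z, SetModel.E z y ∧ SetModel.E z x
  separation : ∀ P : M → Prop, SetModel.DefPred (fun w : Unit → M => P (w ())) →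
    ∀ a, ∃ b, ∀ x, SetModel.E x b ↔ SetModel.E x a ∧ P x
  replacement : ∀ R : M → M → Prop, SetModel.DefPred (fun w : Fin 2 → M => R (w 0) (w 1)) →
    ∀ a, (∀ x, SetModel.E x a → ∀ y z, R x y ∧ R x z → y = z) →
      ∃ b, ∀ y, SetModel.E y b ↔ ∃ x, SetModel.E x a ∧ R x y
  transitiveClosure : ∀ x : M, ∃ t, (∀ z, SetModel.E z x → SetModel.E z t) ∧
    ∀ y, SetModel.E y t → ∀ z, SetModel.E z y → SetModel.E z t

noncomputable section

namespace SetModel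

variable {M : Type} [memLang.Structure M] {ι κ : Type}

/-- `x ⊆ y` in the model. -/
def Sub (x y : M) : Prop := ∀ z, z ε x → z ε y

instance DefPred.sub (s t : (ι → M) → M) [DefFun s] [DefFun t] :
    DefPred fun v => Sub (s v) (t v) :=
  .subst₂ (by unfold Sub; infer_instance) s t

/-- `x` is transitive. -/
def Trans (x : M) : Prop := ∀ y, y ε x → Sub y x

instance DefPred.trans (s : (ι → M) → M) [DefFun s] : DefPred fun v => Trans (s v) :=
  .subst₁ (by unfold Trans; infer_instance) s

/-- `x` is an ordinal. -/
def Ord (x : M) : Prop := Trans x ∧ ∀ y, y ε x → Trans y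

instance DefPred.ord (s : (ι → M) → M) [DefFun s] : DefPred fun v => Ord (s v) :=
  .subst₁ (by unfold Ord; infer_instance) s

theorem Ord.mem {x y : M} (h : Ord x) (hy : y ε x) : Ord y :=
  ⟨h.2 y hy, fun z hz => h.2 z (h.1 y hy z hz)⟩

theorem Ord.trans {x y z : M} (h : Ord x) (hz : z ε y) (hy : y ε x) : z ε x := h.1 y hy z hz

theorem ord_of_forall {x : M} (h : ∀ y, y ε x → Ord y) (ht : Trans x) : Ord x :=
  ⟨ht, fun y hy => (h y hy).1⟩

variable [Nonempty M]

/-- The set of all `x` with `P x`, if there is such a set. -/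
def collect (P : M → Prop) : M := Classical.epsilon fun b => ∀ x, x ε b ↔ P x

theorem mem_collect {P : M → Prop} (h : ∃ b, ∀ x, x ε b ↔ P x) {x : M} : x ε collect P ↔ P x :=
  Classical.epsilon_spec h x

variable [SetModel M]

theorem eq_collect {P : M → Prop} (h : ∃ b, ∀ x, x ε b ↔ P x) {y : M} :
    y = collect P ↔ ∀ x, x ε y ↔ P x :=
  ⟨fun e x => by rw [e, mem_collect h], fun hy => ext _ _ fun z => by rw [hy, mem_collect h]⟩

/-- `{x ∈ a | P x}`. -/
def sep (a : M) (P : M → Prop) : M := collect fun x => x ε a ∧ P x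

theorem mem_sep {a x : M} (P : M → Prop) [hP : DefPred fun w : Unit → M => P (w ())] :
    x ε sep a P ↔ x ε a ∧ P x :=
  mem_collect (separation P hP a)

/-- By extensionality `y = {x ∈ a | P x}` is the first-order condition `∀ x, x ∈ y ↔ x ∈ a ∧ P x`.
The two layers of `Option` carry the value `y` and the bound variable `x`. -/
instance DefFun.sep (a : (ι → M) → M) (P : (ι → M) → M → Prop) [ha : DefFun a]
    [hP : DefPred fun v : Option ι → M => P (fun i => v (some i)) (v none)] :
    DefFun fun v => sep (a v) (P v) := by
  have h₁ := ha.comap (κ := Option (Option ι)) fun i => some (some i)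
  have h₂ : DefPred fun v : Option (Option ι) → M => P (fun i => v (some (some i))) (v none) :=
    hP.comap fun i => Sum.inr (i.elim none fun i => some (some i))
  refine ⟨DefPred.congr (P := fun v : Option ι → M => ∀ x, x ε v none ↔
    x ε a (fun i => v (some i)) ∧ P (fun i => v (some i)) x) inferInstance fun v => ?_⟩
  exact eq_collect (separation _ (hP.fix _) _)

/-- `{F x | x ∈ a}`. -/
def img (a : M) (F : M → M) : M := collect fun y => ∃ x, x ε a ∧ y = F x

theorem mem_img {a y : M} (F : M → M) [hF : DefFun fun w : Fin 1 → M => F (w 0)] :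
    y ε img a F ↔ ∃ x, x ε a ∧ y = F x :=
  mem_collect (replacement (fun x y => y = F x)
    (hF.out.comap (κ := Fin 2) fun i => Sum.inr (i.elim 1 fun _ => 0)) a
    fun _ _ _ _ h => h.1.trans h.2.symm)

/-- The empty set. -/
def empty : M := collect fun _ => False

@[simp] theorem not_mem_empty (x : M) : ¬ x ε (empty : M) := by
  -- No axiom asserts an empty set; it is separated from an arbitrary element of the nonempty model.
  have h := separation (fun _ : M => False) inferInstance (Classical.arbitrary M)
  simp only [and_false] at h
  rw [empty, mem_collect h]
  exact id

theorem eq_empty {x : M} : x = empty ↔ ∀ z, ¬ z ε x :=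
  ⟨fun h z => by simp [h], fun h => ext _ _ fun z => by simp [h]⟩

/-- `{a, b}`. -/
def upair (a b : M) : M := collect fun z => z = a ∨ z = b

@[simp] theorem mem_upair {a b z : M} : z ε upair a b ↔ z = a ∨ z = b := mem_collect (pairing a b)

theorem eq_upair {a b y : M} : y = upair a b ↔ ∀ z, z ε y ↔ z = a ∨ z = b :=
  eq_collect (pairing a b)

instance DefFun.upair (s t : (ι → M) → M) [DefFun s] [DefFun t] :
    DefFun fun v => upair (s v) (t v) :=
  .subst₂ (by simp only [eq_upair]; infer_instance) s t

/-- `⋃ a`. -/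
def sUnion (a : M) : M := collect fun z => ∃ y, y ε a ∧ z ε y

@[simp] theorem mem_sUnion {a z : M} : z ε sUnion a ↔ ∃ y, y ε a ∧ z ε y := mem_collect (union a)

instance DefFun.sUnion (s : (ι → M) → M) [DefFun s] : DefFun fun v => sUnion (s v) :=
  .subst₁ (by simp only [SetModel.sUnion, eq_collect (union _)]; infer_instance) s

/-- The power set. -/
def pow (a : M) : M := collect fun z => Sub z a

@[simp] theorem mem_pow {a z : M} : z ε pow a ↔ Sub z a := mem_collect (powerSet a)

theorem eq_pow {a y : M} : y = pow a ↔ ∀ z, z ε y ↔ Sub z a := eq_collect (powerSet a)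

instance DefFun.pow (s : (ι → M) → M) [DefFun s] : DefFun fun v => pow (s v) :=
  .subst₁ (by simp only [eq_pow]; infer_instance) s

/-- `a ∪ b`. -/
def cup (a b : M) : M := sUnion (upair a b)

@[simp] theorem mem_cup {a b z : M} : z ε cup a b ↔ z ε a ∨ z ε b := by simp [cup]

instance DefFun.cup (s t : (ι → M) → M) [DefFun s] [DefFun t] :
    DefFun fun v => cup (s v) (t v) := by
  unfold SetModel.cup; infer_instance

/-- `a ∪ {a}`. -/
def succ (a : M) : M := cup a (upair a a)

@[simp] theorem mem_succ {a z : M} : z ε succ a ↔ z ε a ∨ z = a := by simp [succ]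

theorem eq_succ {a y : M} : y = succ a ↔ ∀ z, z ε y ↔ z ε a ∨ z = a :=
  ⟨fun h z => by simp [h], fun h => ext _ _ fun z => by simp [h]⟩

instance DefFun.succ (s : (ι → M) → M) [DefFun s] : DefFun fun v => succ (s v) := by
  unfold SetModel.succ; infer_instance

/-- The Kuratowski pair. -/
def pair (a b : M) : M := upair (upair a a) (upair a b)

instance DefFun.pair (s t : (ι → M) → M) [DefFun s] [DefFun t] :
    DefFun fun v => pair (s v) (t v) := by
  unfold SetModel.pair; infer_instance

theorem upair_inj {a b c : M} : upair a b = upair a c ↔ b = c := by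
  refine ⟨fun h => ?_, fun h => by rw [h]⟩
  have h₁ : b ε upair a c := by simp [← h]
  have h₂ : c ε upair a b := by simp [h]
  simp only [mem_upair] at h₁ h₂
  grind

theorem upair_eq_singleton {a b c : M} : upair a b = upair c c ↔ a = c ∧ b = c := by
  refine ⟨fun h => ?_, fun ⟨h₁, h₂⟩ => by rw [h₁, h₂]⟩
  have h₁ : a ε upair c c := by simp [← h]
  have h₂ : b ε upair c c := by simp [← h]
  simpa using And.intro h₁ h₂

@[simp] theorem pair_inj {a b c d : M} : pair a b = pair c d ↔ a = c ∧ b = d := by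
  refine ⟨fun h => ?_, fun ⟨h₁, h₂⟩ => by rw [h₁, h₂]⟩
  have hac : a = c := by
    have h₁ : upair c c ε pair a b := by rw [h]; simp [pair]
    rcases mem_upair.1 h₁ with h₁ | h₁
    · exact (upair_eq_singleton.1 h₁).1.symm
    · exact (upair_eq_singleton.1 h₁.symm).1
  subst hac
  exact ⟨rfl, upair_inj.1 (upair_inj.1 h)⟩

/-- The triple `((a, b), c)`. -/
def triple (a b c : M) : M := pair (pair a b) c

instance DefFun.triple (s t r : (ι → M) → M) [DefFun s] [DefFun t] [DefFun r] :
    DefFun fun v => triple (s v) (t v) (r v) := by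
  unfold SetModel.triple; infer_instance

@[simp] theorem triple_inj {a b c d e f : M} :
    triple a b c = triple d e f ↔ a = d ∧ b = e ∧ c = f := by
  simp [triple, and_assoc]

/-! ### Induction -/

/-- Regularity is applied to the counterexamples inside a transitive set containing `x`. The axiom
of transitive closure is needed because the class of all counterexamples need not be a set. -/
theorem eps_induction (P : M → Prop) [hP : DefPred fun w : Unit → M => P (w ())]
    (h : ∀ x, (∀ y, y ε x → P y) → P x) (x : M) : P x := by
  by_contra hx
  obtain ⟨t, ht, htt⟩ := transitiveClosure (upair x x)
  have hm (z : M) : z ε sep t (fun z => ¬ P z) ↔ z ε t ∧ ¬ P z := mem_sep _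
  obtain ⟨y, hy, hy'⟩ := regularity (sep t fun z => ¬ P z)
    ⟨x, (hm x).2 ⟨ht x (by simp), hx⟩⟩
  rw [hm] at hy
  refine hy.2 (h y fun z hz => ?_)
  by_contra hPz
  exact hy' ⟨z, hz, (hm z).2 ⟨htt y hy.1 z hz, hPz⟩⟩

theorem mem_irrefl (x : M) : ¬ x ε x :=
  eps_induction (fun x => ¬ x ε x) (fun x h hx => h x hx hx) x

theorem mem_asymm {x y : M} (h₁ : y ε x) (h₂ : x ε y) : False :=
  eps_induction (fun x => ∀ y, y ε x → ¬ x ε y) (fun _ h y hy hx => h y hy _ hx hy) x y h₁ h₂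

theorem succ_inj {a b : M} : succ a = succ b ↔ a = b := by
  refine ⟨fun h => ?_, fun h => by rw [h]⟩
  have h₁ : a ε succ b := by simp [← h]
  have h₂ : b ε succ a := by simp [h]
  rw [mem_succ] at h₁ h₂
  rcases h₁ with h₁ | h₁
  · rcases h₂ with h₂ | h₂
    · exact (mem_asymm h₁ h₂).elim
    · exact h₂.symm
  · exact h₁

theorem succ_ne_empty {a : M} : succ a ≠ empty := fun h => eq_empty.1 h a (by simp)

/-! ### Ordinals -/

theorem ord_empty : Ord (empty : M) :=
  ⟨fun y hy => (not_mem_empty y hy).elim, fun y hy => (not_mem_empty y hy).elim⟩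

theorem Ord.succ {x : M} (h : Ord x) : Ord (succ x) := by
  refine ⟨fun y hy z hz => ?_, fun y hy => ?_⟩ <;> rw [mem_succ] at hy
  · rcases hy with hy | rfl
    · exact mem_succ.2 (.inl (h.trans hz hy))
    · exact mem_succ.2 (.inl hz)
  · rcases hy with hy | rfl
    · exact h.2 y hy
    · exact h.1

theorem Ord.of_succ {x : M} (h : Ord (SetModel.succ x)) : Ord x := h.mem (by simp)

theorem ord_induction (P : M → Prop) [hP : DefPred fun w : Unit → M => P (w ())]
    (h : ∀ x, Ord x → (∀ y, y ε x → P y) → P x) {x : M} (hx : Ord x) : P x :=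
  eps_induction (fun x => Ord x → P x) (fun x ih hx => h x hx fun y hy => ih y hy (hx.mem hy)) x hx

/-- Double induction: if neither ordinal has an element outside the other, they are equal; an
element outside is compared by one of the two induction hypotheses. -/
theorem Ord.trichotomy {x y : M} (hx : Ord x) (hy : Ord y) : x ε y ∨ x = y ∨ y ε x := by
  refine ord_induction (fun x => ∀ y, Ord y → x ε y ∨ x = y ∨ y ε x) (fun x hx ihx y hy => ?_)
    hx y hy
  refine ord_induction (fun y => x ε y ∨ x = y ∨ y ε x) (fun y hy ihy => ?_) hy
  by_cases h₁ : ∃ z, z ε x ∧ ¬ z ε y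
  · obtain ⟨z, hz, hzy⟩ := h₁
    rcases ihx z hz y hy with h | rfl | h
    · exact (hzy h).elim
    · exact .inr (.inr hz)
    · exact .inr (.inr (hx.trans h hz))
  by_cases h₂ : ∃ z, z ε y ∧ ¬ z ε x
  · obtain ⟨z, hz, hzx⟩ := h₂
    rcases ihy z hz with h | rfl | h
    · exact .inl (hy.trans h hz)
    · exact .inl hz
    · exact (hzx h).elim
  · push Not at h₁ h₂
    exact .inr (.inl (ext _ _ fun z => ⟨h₁ z, h₂ z⟩))

/-- Membership in `succ y` serves throughout as the relation `≤` between ordinals. -/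
theorem Ord.mem_succ_of_sub {x y : M} (hx : Ord x) (hy : Ord y) (h : Sub x y) :
    x ε SetModel.succ y := by
  rw [mem_succ]
  rcases hx.trichotomy hy with h' | h' | h'
  · exact .inl h'
  · exact .inr h'
  · exact (mem_irrefl y (h y h')).elim

theorem Ord.succ_mem_succ {x y : M} (hx : Ord x) (h : y ε x) :
    SetModel.succ y ε SetModel.succ x := by
  refine (hx.mem h).succ.mem_succ_of_sub hx fun z hz => ?_
  rcases mem_succ.1 hz with hz | rfl
  · exact hx.trans hz h
  · exact h

theorem Ord.mem_of_succ_mem_succ {x y : M} (hx : Ord x)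
    (h : SetModel.succ y ε SetModel.succ x) : y ε x := by
  rcases mem_succ.1 h with h | h
  · exact hx.trans (by simp) h
  · simp [← h]

/-- `x` is a limit ordinal. -/
def Limit (x : M) : Prop := Ord x ∧ x ≠ empty ∧ ¬ ∃ y, x = succ y

instance DefPred.limit (s : (ι → M) → M) [DefFun s] : DefPred fun v => Limit (s v) :=
  .subst₁ (by unfold Limit; infer_instance) s

theorem Limit.succ_mem {x y : M} (hx : Limit x) (hy : y ε x) : succ y ε x := by
  rcases mem_succ.1 (hx.1.succ_mem_succ hy) with h | h
  · exact h
  · exact (hx.2.2 ⟨y, h.symm⟩).elim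

theorem Ord.cases {x : M} (hx : Ord x) : x = empty ∨ (∃ y, Ord y ∧ x = SetModel.succ y) ∨ Limit x := by
  by_cases h₁ : x = empty
  · exact .inl h₁
  by_cases h₂ : ∃ y, x = SetModel.succ y
  · obtain ⟨y, rfl⟩ := h₂
    exact .inr (.inl ⟨y, hx.of_succ, rfl⟩)
  · exact .inr (.inr ⟨hx, h₁, h₂⟩)

theorem limit_ord_induction (P : M → Prop) [hP : DefPred fun w : Unit → M => P (w ())]
    (zero : P empty) (succ : ∀ x, Ord x → P x → P (succ x))
    (limit : ∀ x, Limit x → (∀ y, y ε x → P y) → P x) {x : M} (hx : Ord x) : P x := by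
  refine ord_induction P (fun x hx ih => ?_) hx
  rcases hx.cases with rfl | ⟨y, hy, rfl⟩ | h
  · exact zero
  · exact succ y hy (ih y (by simp))
  · exact limit x h ih

theorem exists_least_ord (P : M → Prop) [hP : DefPred fun w : Unit → M => P (w ())]
    (h : ∃ x, Ord x ∧ P x) : ∃ x, Ord x ∧ P x ∧ ∀ y, y ε x → ¬ P y := by
  by_contra! hc
  obtain ⟨x, hx, hPx⟩ := h
  refine ord_induction (fun x => ¬ P x) (fun x hx ih hP => ?_) hx hPx
  obtain ⟨y, hy, hPy⟩ := hc x hx hP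
  exact ih y hy hPy

end SetModel

end

noncomputable section

namespace SetModel

variable {M : Type} [memLang.Structure M] [Nonempty M] {ι κ : Type}

/-! ### Transfinite recursion -/

/-- `f` is a function with domain `d`. -/
def FunOn (f d : M) : Prop :=
  (∀ p, p ε f → ∃ x y, x ε d ∧ p = pair x y) ∧
  ∀ x, x ε d → ∃ y, pair x y ε f ∧ ∀ z, pair x z ε f → z = y

theorem FunOn.unique {f d x y z : M} (h : FunOn f d) (hx : x ε d) (hy : pair x y ε f)
    (hz : pair x z ε f) : y = z := by
  obtain ⟨w, -, hw⟩ := h.2 x hx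
  rw [hw y hy, hw z hz]

/-- `f` is the restriction to `α + 1` of the function defined by transfinite recursion from the
relation `Step`. -/
def Approx (Step : M → M → M → Prop) (α f : M) : Prop :=
  FunOn f (succ α) ∧ pair empty empty ε f ∧
  (∀ β β' u u', β ε α ∧ β' = succ β ∧ pair β u ε f ∧ pair β' u' ε f → Step β u u') ∧
  ∀ γ u, γ ε succ α ∧ Limit γ ∧ pair γ u ε f →
    ∀ t, t ε u ↔ ∃ β w, β ε γ ∧ pair β w ε f ∧ t ε w

/-- `y` is the value at `α` of the function defined by transfinite recursion from `Step`. -/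
def RecRel (Step : M → M → M → Prop) (α y : M) : Prop :=
  Ord α ∧ ∃ f, Approx Step α f ∧ pair α y ε f

/-- An approximation on `α + 1` consults the step relation only at elements of `α`, which are
ordinals. -/
theorem RecRel.congr {Step Step' : M → M → M → Prop}
    (h : ∀ β, Ord β → ∀ u u', Step β u u' ↔ Step' β u u') (α y : M) :
    RecRel Step α y ↔ RecRel Step' α y := by
  refine and_congr_right fun hα => exists_congr fun f => and_congr_left' <| and_congr_right fun _ =>
    and_congr_right fun _ => and_congr_left' ?_
  refine forall_congr' fun β => forall_congr' fun β' => forall_congr' fun u => forall_congr' fun u' =>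
    ⟨fun H hβ => ?_, fun H hβ => ?_⟩
  · exact (h β (hα.mem hβ.1) u u').1 (H hβ)
  · exact (h β (hα.mem hβ.1) u u').2 (H hβ)

/-- The relation `u' = G(β, u)`. -/
abbrev Graph (G : M → M → M) (β u u' : M) : Prop := u' = G β u

/-- The value at `α` of the function `F` defined by `F(0) = ∅`, `F(β + 1) = G(β, F(β))` and
`F(γ) = ⋃_{β < γ} F(β)` for limit `γ`. -/
def recFun (G : M → M → M) (α : M) : M :=
  open Classical in
  if h : ∃ y, RecRel (Graph G) α y then h.choose else empty

variable [SetModel M]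

instance DefPred.funOn (s t : (ι → M) → M) [DefFun s] [DefFun t] :
    DefPred fun v => FunOn (s v) (t v) :=
  .subst₂ (by unfold FunOn; infer_instance) s t

variable {G : M → M → M}

/-- Induction on `β`: the clauses for zero, successors and limits each determine the value at `β`
from the earlier ones. The approximations may have different lengths. -/
theorem Approx.unique {α α' f f' : M} (hα : Ord α) (hα' : Ord α')
    (hf : Approx (Graph G) α f) (hf' : Approx (Graph G) α' f')
    {β u u' : M} (h₁ : β ε succ α) (h₂ : β ε succ α') (hu : pair β u ε f) (hu' : pair β u' ε f') :
    u = u' := by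
  refine ord_induction (fun β => β ε succ α → β ε succ α' →
    ∀ u u', pair β u ε f → pair β u' ε f' → u = u') (fun β hβ ih h₁ h₂ u u' hu hu' => ?_)
    (hα.succ.mem h₁) h₁ h₂ u u' hu hu'
  obtain ⟨fF, fE, fS, fL⟩ := hf
  obtain ⟨fF', fE', fS', fL'⟩ := hf'
  rcases hβ.cases with rfl | ⟨δ, hδ, rfl⟩ | hl
  · rw [fF.unique h₁ hu fE, fF'.unique h₂ hu' fE']
  · have d₁ := hα.mem_of_succ_mem_succ h₁
    have d₂ := hα'.mem_of_succ_mem_succ h₂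
    have e₁ : δ ε succ α := mem_succ.2 (.inl d₁)
    have e₂ : δ ε succ α' := mem_succ.2 (.inl d₂)
    obtain ⟨y, hy, -⟩ := fF.2 δ e₁
    obtain ⟨y', hy', -⟩ := fF'.2 δ e₂
    rw [fS δ _ y u ⟨d₁, rfl, hy, hu⟩, fS' δ _ y' u' ⟨d₂, rfl, hy', hu'⟩,
      ih δ (by simp) e₁ e₂ y y' hy hy']
  · refine ext _ _ fun t => ?_
    rw [fL β u ⟨h₁, hl, hu⟩ t, fL' β u' ⟨h₂, hl, hu'⟩ t]
    refine exists_congr fun δ => ⟨?_, ?_⟩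
    · rintro ⟨w, hδ, hw, ht⟩
      have e₁ := hα.succ.trans hδ h₁
      have e₂ := hα'.succ.trans hδ h₂
      obtain ⟨y', hy', -⟩ := fF'.2 δ e₂
      exact ⟨y', hδ, hy', ih δ hδ e₁ e₂ w y' hw hy' ▸ ht⟩
    · rintro ⟨w, hδ, hw, ht⟩
      have e₁ := hα.succ.trans hδ h₁
      have e₂ := hα'.succ.trans hδ h₂
      obtain ⟨y, hy, -⟩ := fF.2 δ e₁
      exact ⟨y, hδ, hy, ih δ hδ e₁ e₂ y w hy hw ▸ ht⟩

theorem RecRel.unique {α y z : M} (hy : RecRel (Graph G) α y)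
    (hz : RecRel (Graph G) α z) : y = z := by
  obtain ⟨hα, f, hf, hfy⟩ := hy
  obtain ⟨-, g, hg, hgz⟩ := hz
  exact hf.unique hα hα hg (by simp) (by simp) hfy hgz

theorem recRel_recFun_iff {α y : M} : RecRel (Graph G) α y ↔
    (∃ z, RecRel (Graph G) α z) ∧ y = recFun G α := by
  constructor
  · intro h
    have h' : ∃ z, RecRel (Graph G) α z := ⟨y, h⟩
    refine ⟨h', ?_⟩
    rw [recFun, dif_pos h']
    exact h.unique h'.choose_spec
  · rintro ⟨h, rfl⟩
    rw [recFun, dif_pos h]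
    exact h.choose_spec

/-- Separation cuts `f` down to the pairs with first component in `γ + 1`, and every clause is
inherited. -/
theorem Approx.restrict {Step : M → M → M → Prop} {α f γ : M} (hα : Ord α) (hf : Approx Step α f)
    (hγ : γ ε succ α) :
    ∃ g, Approx Step γ g ∧ ∀ β u, pair β u ε g ↔ β ε succ γ ∧ pair β u ε f := by
  obtain ⟨fF, fE, fS, fL⟩ := hf
  have hγ' := hα.succ.mem hγ
  have hsub : Sub (succ γ) (succ α) := fun z hz => by
    rcases mem_succ.1 hz with hz | rfl
    · exact hα.succ.trans hz hγ
    · exact hγ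
  have hm (p : M) : p ε sep f (fun p => ∃ β u, β ε succ γ ∧ p = pair β u) ↔
    p ε f ∧ ∃ β u, β ε succ γ ∧ p = pair β u := mem_sep _
  have hg (β u : M) : pair β u ε sep f (fun p => ∃ β u, β ε succ γ ∧ p = pair β u) ↔
      β ε succ γ ∧ pair β u ε f := by
    rw [hm]
    refine ⟨?_, fun h => ⟨h.2, β, u, h.1, rfl⟩⟩
    rintro ⟨h, β', u', h', e⟩
    rw [pair_inj] at e
    exact ⟨e.1 ▸ h', h⟩
  refine ⟨_, ⟨⟨fun p hp => ((hm p).1 hp).2, fun x hx => ?_⟩, ?_, ?_, ?_⟩, hg⟩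
  · obtain ⟨y, hy, hy'⟩ := fF.2 x (hsub x hx)
    exact ⟨y, (hg x y).2 ⟨hx, hy⟩, fun z hz => hy' z ((hg x z).1 hz).2⟩
  · refine (hg _ _).2 ⟨ord_empty.mem_succ_of_sub hγ' fun z hz => (not_mem_empty z hz).elim, fE⟩
  · rintro β β' u u' ⟨hβ, rfl, hu, hu'⟩
    refine fS β _ u u' ⟨?_, rfl, ((hg _ _).1 hu).2, ((hg _ _).1 hu').2⟩
    exact hα.mem_of_succ_mem_succ (hsub _ (hγ'.succ_mem_succ hβ))
  · rintro δ u ⟨hδ, hl, hu⟩ t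
    rw [fL δ u ⟨hsub δ hδ, hl, ((hg _ _).1 hu).2⟩ t]
    refine exists_congr fun β => exists_congr fun w => ?_
    rw [hg]
    refine ⟨fun h => ⟨h.1, ⟨hγ'.succ.trans h.1 hδ, h.2.1⟩, h.2.2⟩, fun h => ⟨h.1, h.2.1.2, h.2.2⟩⟩

/-- The values of an approximation are the values of `recFun`. -/
theorem Approx.eq_recFun {α f β u : M} (hα : Ord α)
    (hf : Approx (Graph G) α f) (hβ : β ε succ α) :
    pair β u ε f ↔ RecRel (Graph G) β u := by
  constructor
  · intro h
    obtain ⟨g, hg, hgf⟩ := hf.restrict hα hβ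
    exact ⟨hα.succ.mem hβ, g, hg, (hgf β u).2 ⟨by simp, h⟩⟩
  · rintro ⟨h, g, hg, hu⟩
    obtain ⟨y, hy, -⟩ := hf.1.2 β hβ
    rwa [hg.unique h hα hf (by simp) hβ hu hy]

theorem recFun_empty_of {y : M} (h : RecRel (Graph G) empty y) : y = empty := by
  obtain ⟨h, g, hg, hu⟩ := h
  exact hg.1.unique (by simp) hu hg.2.1

theorem recFun_succ_of {β u u' : M} (h : RecRel (Graph G) (succ β) u')
    (hu : RecRel (Graph G) β u) : u' = G β u := by
  obtain ⟨h, g, hg, hu'⟩ := h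
  exact hg.2.2.1 β _ u u' ⟨by simp, rfl, (hg.eq_recFun h (by simp)).2 hu, hu'⟩

theorem recFun_limit_of {γ u : M} (h : RecRel (Graph G) γ u) (hl : Limit γ)
    (t : M) : t ε u ↔ ∃ β w, β ε γ ∧ RecRel (Graph G) β w ∧ t ε w := by
  obtain ⟨h, g, hg, hu⟩ := h
  rw [hg.2.2.2 γ u ⟨by simp, hl, hu⟩ t]
  refine exists_congr fun β => exists_congr fun w => and_congr_right fun hβ => ?_
  rw [hg.eq_recFun h (by simp [hβ])]

/-! ### Existence and definability for recursion along a definable function -/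

section

variable [hG : DefFun fun w : Fin 2 → M => G (w 0) (w 1)]

instance DefPred.recRel (s t : (ι → M) → M) [DefFun s] [DefFun t] :
    DefPred fun v => RecRel (Graph G) (s v) (t v) := by
  have h {ι : Type} (s t : (ι → M) → M) [DefFun s] [DefFun t] : DefFun fun v => G (s v) (t v) :=
    DefFun.apply₂ s t
  exact .subst₂ (by unfold RecRel Approx; infer_instance) s t

/-- The default value makes `recFun` definable before existence is known. The existence proof needs
this in order to apply replacement to `recFun G` below `α`. -/
instance DefFun.recFun (s : (ι → M) → M) [DefFun s] : DefFun fun v => recFun G (s v) := by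
  refine .subst₁ (DefPred.congr (P := fun w : Fin 2 → M => RecRel (Graph G) (w 1) (w 0) ∨
    (¬ ∃ z, RecRel (Graph G) (w 1) z) ∧ w 0 = empty) inferInstance fun w => ?_) s
  by_cases h : ∃ z, RecRel (Graph G) (w 1) z
  · simp [recRel_recFun_iff (y := w 0), h]
  · simp only [h, not_false_eq_true, true_and]
    rw [SetModel.recFun, dif_neg h]
    exact (or_iff_right fun h' => h ⟨_, h'⟩).symm

theorem exists_recRel {α : M} (hα : Ord α) : ∃ y, RecRel (Graph G) α y := by
  refine ord_induction (fun α => ∃ y, RecRel (Graph G) α y)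
    (fun α hα ih => ?_) hα
  have hr (β : M) (hβ : β ε α) (u : M) :
      RecRel (Graph G) β u ↔ u = recFun G β := by
    rw [recRel_recFun_iff, and_iff_right (ih β hβ)]
  obtain ⟨Y, hY0, hYS, hYL⟩ : ∃ Y, (α = empty → Y = empty) ∧
      (∀ δ, α = succ δ → Y = G δ (recFun G δ)) ∧
      (Limit α → ∀ t, t ε Y ↔ ∃ β, β ε α ∧ t ε recFun G β) := by
    rcases hα.cases with rfl | ⟨δ, hδ, rfl⟩ | hl
    · exact ⟨empty, fun _ => rfl, fun δ h => (succ_ne_empty h.symm).elim, fun h => (h.2.1 rfl).elim⟩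
    · refine ⟨G δ (recFun G δ), fun h => (succ_ne_empty h).elim, fun δ' h => ?_,
        fun h => (h.2.2 ⟨δ, rfl⟩).elim⟩
      rw [succ_inj.1 h]
    · refine ⟨sUnion (img α (recFun G)), fun h => (hl.2.1 h).elim,
        fun δ h => (hl.2.2 ⟨δ, h⟩).elim, fun _ t => ?_⟩
      simp only [mem_sUnion, mem_img]
      exact ⟨fun ⟨y, ⟨β, hβ, e⟩, ht⟩ => ⟨β, hβ, e ▸ ht⟩, fun ⟨β, hβ, ht⟩ => ⟨_, ⟨β, hβ, rfl⟩, ht⟩⟩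
  -- The values below `α` are known by induction; only the pair `(α, Y)` is added.
  let f := cup (img α fun β => pair β (recFun G β)) (upair (pair α Y) (pair α Y))
  have hf (p : M) : p ε f ↔ (∃ β, β ε α ∧ p = pair β (recFun G β)) ∨ p = pair α Y := by
    simp only [f, mem_cup, mem_upair, or_self]
    rw [mem_img]
  have hfp (β u : M) : pair β u ε f ↔ (β ε α ∧ u = recFun G β) ∨ (β = α ∧ u = Y) := by
    simp only [hf, pair_inj]
    refine or_congr_left ⟨?_, fun h => ⟨β, h.1, rfl, h.2⟩⟩
    rintro ⟨β', h, rfl, h'⟩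
    exact ⟨h, h'⟩
  have hfα (β u : M) (hβ : β ε α) : pair β u ε f ↔ u = recFun G β := by
    rw [hfp, and_iff_right hβ, or_iff_left]
    rintro ⟨rfl, -⟩
    exact mem_irrefl β hβ
  have hfY (u : M) : pair α u ε f ↔ u = Y := by
    rw [hfp, or_iff_right, and_iff_right rfl]
    exact fun h => mem_irrefl α h.1
  refine ⟨Y, hα, f, ⟨⟨fun p hp => ?_, fun x hx => ?_⟩, ?_, ?_, ?_⟩, (hfY Y).2 rfl⟩
  · rcases (hf p).1 hp with ⟨β, hβ, e⟩ | e
    · exact ⟨β, _, mem_succ.2 (.inl hβ), e⟩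
    · exact ⟨α, Y, by simp, e⟩
  · rcases mem_succ.1 hx with hx | rfl
    · exact ⟨_, (hfα x _ hx).2 rfl, fun z hz => (hfα x z hx).1 hz⟩
    · exact ⟨Y, (hfY Y).2 rfl, fun z hz => (hfY z).1 hz⟩
  · rcases mem_succ.1 (ord_empty.mem_succ_of_sub hα fun z hz => (not_mem_empty z hz).elim) with h | h
    · exact (hfα _ _ h).2 (recFun_empty_of ((hr _ h _).2 rfl)).symm
    · rw [h, hfY, hY0 h.symm, h]
  · rintro β _ u u' ⟨hβ, rfl, hu, hu'⟩
    rw [hfα β u hβ] at hu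
    rcases mem_succ.1 (hα.succ_mem_succ hβ) with h | h
    · rw [hfα _ u' h] at hu'
      exact recFun_succ_of ((hr _ h _).2 hu') ((hr _ hβ _).2 hu)
    · rw [h, hfY] at hu'
      rw [hu', hu, hYS β h.symm]
  · rintro γ u ⟨hγ, hl, hu⟩ t
    have key : (∃ β w, β ε γ ∧ pair β w ε f ∧ t ε w) ↔ ∃ β, β ε γ ∧ t ε recFun G β := by
      refine exists_congr fun β => ⟨?_, fun ⟨h, ht⟩ => ⟨_, h, (hfα _ _ ?_).2 rfl, ht⟩⟩
      · rintro ⟨w, hβ, hw, ht⟩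
        refine ⟨hβ, ?_⟩
        rwa [← (hfα β w ?_).1 hw]
        rcases mem_succ.1 hγ with h | rfl
        · exact hα.trans hβ h
        · exact hβ
      · rcases mem_succ.1 hγ with h' | rfl
        · exact hα.trans h h'
        · exact h
    rw [key]
    rcases mem_succ.1 hγ with h | rfl
    · rw [hfα γ u h] at hu
      rw [recFun_limit_of ((hr _ h _).2 hu) hl]
      refine exists_congr fun β => ⟨?_, fun ⟨hβ, ht⟩ => ⟨_, hβ, (hr _ (hα.trans hβ h) _).2 rfl, ht⟩⟩
      rintro ⟨w, hβ, hw, ht⟩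
      exact ⟨hβ, (hr _ (hα.trans hβ h) _).1 hw ▸ ht⟩
    · rw [hfY] at hu
      rw [hu, hYL hl]

theorem recRel_iff {α y : M} :
    RecRel (Graph G) α y ↔ Ord α ∧ y = recFun G α :=
  ⟨fun h => ⟨h.1, (recRel_recFun_iff.1 h).2⟩,
    fun h => recRel_recFun_iff.2 ⟨exists_recRel h.1, h.2⟩⟩

theorem recFun_empty : recFun G empty = empty :=
  recFun_empty_of (recRel_iff.2 ⟨ord_empty, rfl⟩)

theorem recFun_succ {α : M} (hα : Ord α) :
    recFun G (succ α) = G α (recFun G α) :=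
  recFun_succ_of (recRel_iff.2 ⟨hα.succ, rfl⟩) (recRel_iff.2 ⟨hα, rfl⟩)

theorem mem_recFun_limit {α t : M} (hα : Limit α) :
    t ε recFun G α ↔ ∃ β, β ε α ∧ t ε recFun G β := by
  rw [recFun_limit_of (recRel_iff.2 ⟨hα.1, rfl⟩) hα]
  refine exists_congr fun β => ⟨?_, fun ⟨hβ, ht⟩ => ⟨_, hβ, recRel_iff.2 ⟨hα.1.mem hβ, rfl⟩, ht⟩⟩
  rintro ⟨w, hβ, hw, ht⟩
  exact ⟨hβ, (recRel_iff.1 hw).2 ▸ ht⟩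

end

end SetModel

end

noncomputable section

namespace SetModel

variable {M : Type} [memLang.Structure M] [Nonempty M] {ι κ : Type}

/-! ### Multiples of six and the cumulative hierarchy -/

/-- `x + 3`. -/
def addThree (x : M) : M := succ (succ (succ x))

/-- `x + 6`. -/
def addSix (x : M) : M := addThree (addThree x)

/-- `6 α`. -/
def six (α : M) : M := recFun (fun _ u => addSix u) α

/-- The level `V_α` of the cumulative hierarchy. -/
def V (α : M) : M := recFun (fun _ u => pow u) α

variable [SetModel M]

instance DefFun.addThree (s : (ι → M) → M) [DefFun s] : DefFun fun v => addThree (s v) := by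
  unfold SetModel.addThree; infer_instance

instance DefFun.addSix (s : (ι → M) → M) [DefFun s] : DefFun fun v => addSix (s v) := by
  unfold SetModel.addSix; infer_instance

instance DefFun.six (s : (ι → M) → M) [DefFun s] : DefFun fun v => six (s v) := by
  unfold SetModel.six; infer_instance

instance DefFun.V (s : (ι → M) → M) [DefFun s] : DefFun fun v => V (s v) := by
  unfold SetModel.V; infer_instance

theorem Ord.addThree {x : M} (h : Ord x) : Ord (addThree x) := h.succ.succ.succ

theorem Ord.addSix {x : M} (h : Ord x) : Ord (addSix x) := h.addThree.addThree

theorem mem_addThree (x : M) : x ε addThree x := by simp [addThree]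

theorem mem_addSix (x : M) : x ε addSix x := by simp [addSix, addThree]

theorem six_empty : six (empty : M) = empty := recFun_empty

theorem six_succ {α : M} (hα : Ord α) : six (succ α) = addSix (six α) := recFun_succ hα

theorem mem_six_limit {α t : M} (hα : Limit α) : t ε six α ↔ ∃ β, β ε α ∧ t ε six β :=
  mem_recFun_limit hα

theorem Ord.six {α : M} (hα : Ord α) : Ord (six α) := by
  refine limit_ord_induction (fun α => Ord (SetModel.six α)) ?_ (fun α hα h => ?_)
    (fun α hα ih => ?_) hα
  · rw [six_empty]
    exact ord_empty
  · rw [six_succ hα]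
    exact h.addSix
  · refine ord_of_forall (fun y hy => ?_) fun y hy z hz => ?_
    · obtain ⟨β, hβ, hy⟩ := (mem_six_limit hα).1 hy
      exact (ih β hβ).mem hy
    · obtain ⟨β, hβ, hy⟩ := (mem_six_limit hα).1 hy
      exact (mem_six_limit hα).2 ⟨β, hβ, (ih β hβ).trans hz hy⟩

theorem Ord.six_mem_six {α β : M} (hα : Ord α) (h : β ε α) : SetModel.six β ε SetModel.six α := by
  refine limit_ord_induction (fun α => ∀ β, β ε α → SetModel.six β ε SetModel.six α) ?_
    (fun α hα ih β hβ => ?_) (fun α hα ih β hβ => ?_) hα β h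
  · exact fun β hβ => (not_mem_empty β hβ).elim
  · rw [six_succ hα]
    rcases mem_succ.1 hβ with hβ | rfl
    · exact hα.six.addSix.trans (ih β hβ) (mem_addSix _)
    · exact mem_addSix _
  · exact (mem_six_limit hα).2 ⟨SetModel.succ β, hα.succ_mem hβ, ih _ (hα.succ_mem hβ) _ (by simp)⟩

/-! ### Ranks in the cumulative hierarchy -/

theorem V_empty : V (empty : M) = empty := recFun_empty

theorem V_succ {α : M} (hα : Ord α) : V (succ α) = pow (V α) := recFun_succ hα

theorem mem_V_succ {α x : M} (hα : Ord α) : x ε V (succ α) ↔ Sub x (V α) := by simp [V_succ hα]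

theorem mem_V_limit {α t : M} (hα : Limit α) : t ε V α ↔ ∃ β, β ε α ∧ t ε V β :=
  mem_recFun_limit hα

/-- `V_α` is the union of the power sets of `V_β` for `β < α`, uniformly for zero, successors and
limits. Monotonicity and transitivity follow from this form. -/
theorem mem_V {α x : M} (hα : Ord α) : x ε V α ↔ ∃ β, β ε α ∧ Sub x (V β) := by
  refine ord_induction (fun α => ∀ x, x ε V α ↔ ∃ β, β ε α ∧ Sub x (V β)) (fun α hα ih x => ?_)
    hα x
  rcases hα.cases with rfl | ⟨δ, hδ, rfl⟩ | hl
  · simp [V_empty]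
  · rw [mem_V_succ hδ]
    refine ⟨fun h => ⟨δ, by simp, h⟩, ?_⟩
    rintro ⟨β, hβ, h⟩
    rcases mem_succ.1 hβ with hβ' | rfl
    · intro z hz
      obtain ⟨γ, hγ, hz⟩ := (ih β hβ z).1 (h z hz)
      exact (ih δ (by simp) z).2 ⟨γ, hδ.trans hγ hβ', hz⟩
    · exact h
  · rw [mem_V_limit hl]
    constructor
    · rintro ⟨β, hβ, h⟩
      obtain ⟨γ, hγ, h⟩ := (ih β hβ x).1 h
      exact ⟨γ, hα.trans hγ hβ, h⟩
    · rintro ⟨β, hβ, h⟩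
      exact ⟨succ β, hl.succ_mem hβ, (mem_V_succ (hα.mem hβ)).2 h⟩

theorem V_mono {α β : M} (hα : Ord α) (h : β ε α) : Sub (V β) (V α) := fun z hz => by
  obtain ⟨γ, hγ, hz⟩ := (mem_V (hα.mem h)).1 hz
  exact (mem_V hα).2 ⟨γ, hα.trans hγ h, hz⟩

theorem V_mono_succ {α : M} (hα : Ord α) : Sub (V α) (V (succ α)) := V_mono hα.succ (by simp)

theorem V_trans {α x y : M} (hα : Ord α) (hx : x ε V α) (hy : y ε x) : y ε V α := by
  obtain ⟨β, hβ, h⟩ := (mem_V hα).1 hx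
  exact V_mono hα hβ y (h y hy)

theorem Ord.not_mem_V {α : M} (hα : Ord α) : ¬ α ε V α := by
  refine ord_induction (fun α => ¬ α ε V α) (fun α hα ih h => ?_) hα
  obtain ⟨β, hβ, h⟩ := (mem_V hα).1 h
  exact ih β hβ (h β hβ)

theorem Ord.mem_V_succ {α : M} (hα : Ord α) : α ε V (SetModel.succ α) := by
  refine ord_induction (fun α => α ε V (SetModel.succ α)) (fun α hα ih => ?_) hα
  refine (SetModel.mem_V_succ hα).2 fun β hβ => ?_
  have := (SetModel.mem_V_succ (hα.mem hβ)).1 (ih β hβ)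
  exact (mem_V hα).2 ⟨β, hβ, this⟩

theorem upair_mem_V {α x y : M} (hα : Ord α) (hx : x ε V α) (hy : y ε V α) :
    upair x y ε V (succ α) := by
  refine (mem_V_succ hα).2 fun z hz => ?_
  rcases mem_upair.1 hz with rfl | rfl
  · exact hx
  · exact hy

theorem pair_mem_V {α x y : M} (hα : Ord α) (hx : x ε V α) (hy : y ε V α) :
    pair x y ε V (succ (succ α)) :=
  upair_mem_V hα.succ (upair_mem_V hα hx hx) (upair_mem_V hα hx hy)

/-- Each Kuratowski pair costs two levels, so a triple costs four. -/
theorem triple_mem_V {α x y z : M} (hα : Ord α) (hx : x ε V α) (hy : y ε V α) (hz : z ε V α) :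
    triple x y z ε V (succ (succ (succ (succ α)))) :=
  pair_mem_V hα.succ.succ (pair_mem_V hα hx hy)
    (V_mono_succ hα.succ _ (V_mono_succ hα _ hz))

theorem fst_mem_of_pair_mem_V {α x y : M} (hα : Ord α) (h : pair x y ε V α) : x ε V α :=
  V_trans hα (V_trans hα h (y := upair x x) (by simp [pair])) (by simp)

/-- The least `α` with `x ∈ V_{6 α}`, or `∅` if there is none. -/
def level (x : M) : M :=
  Classical.epsilon fun α => (Ord α ∧ x ε V (six α) ∧ ∀ β, β ε α → ¬ x ε V (six β)) ∨
    (¬ ∃ α, Ord α ∧ x ε V (six α)) ∧ α = empty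

theorem exists_level (x : M) : ∃ α, (Ord α ∧ x ε V (six α) ∧ ∀ β, β ε α → ¬ x ε V (six β)) ∨
    (¬ ∃ α, Ord α ∧ x ε V (six α)) ∧ α = empty := by
  by_cases h : ∃ α, Ord α ∧ x ε V (six α)
  · obtain ⟨α, h⟩ := exists_least_ord (fun α => x ε V (six α)) h
    exact ⟨α, .inl h⟩
  · exact ⟨empty, .inr ⟨h, rfl⟩⟩

theorem eq_level {x α : M} : α = level x ↔
    (Ord α ∧ x ε V (six α) ∧ ∀ β, β ε α → ¬ x ε V (six β)) ∨
    (¬ ∃ α, Ord α ∧ x ε V (six α)) ∧ α = empty := by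
  have hl : (Ord (level x) ∧ x ε V (six (level x)) ∧ ∀ β, β ε level x → ¬ x ε V (six β)) ∨
    (¬ ∃ α, Ord α ∧ x ε V (six α)) ∧ level x = empty := Classical.epsilon_spec (exists_level x)
  constructor
  · rintro rfl
    exact hl
  · rintro (⟨h₁, h₂, h₃⟩ | ⟨h₁, h₂⟩)
    · rcases hl with ⟨l₁, l₂, l₃⟩ | ⟨l₁, -⟩
      · rcases h₁.trichotomy l₁ with h | h | h
        · exact (l₃ _ h h₂).elim
        · exact h
        · exact (h₃ _ h l₂).elim
      · exact (l₁ ⟨α, h₁, h₂⟩).elim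
    · rcases hl with ⟨l₁, l₂, l₃⟩ | ⟨-, l₂⟩
      · exact (h₁ ⟨_, l₁, l₂⟩).elim
      · rw [h₂, l₂]

instance DefFun.level (s : (ι → M) → M) [DefFun s] : DefFun fun v => level (s v) :=
  .subst₁ (by simp only [eq_level]; infer_instance) s

theorem exists_mem_V_six (x : M) : ∃ α, Ord α ∧ x ε V (six α) := by
  refine eps_induction (fun x => ∃ α, Ord α ∧ x ε V (six α)) (fun x ih => ?_) x
  have hl (y : M) (hy : y ε x) : Ord (level y) ∧ y ε V (six (level y)) := by
    rcases (eq_level (x := y)).1 rfl with h | h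
    · exact ⟨h.1, h.2.1⟩
    · exact (h.1 (ih y hy)).elim
  let σ := sUnion (img x level)
  have hσ (z : M) : z ε σ ↔ ∃ y, y ε x ∧ z ε level y := by
    simp only [σ, mem_sUnion, mem_img]
    exact ⟨fun ⟨_, ⟨y, hy, e⟩, hz⟩ => ⟨y, hy, e ▸ hz⟩, fun ⟨y, hy, hz⟩ => ⟨_, ⟨y, hy, rfl⟩, hz⟩⟩
  have hσo : Ord σ := by
    refine ord_of_forall (fun z hz => ?_) fun z hz t ht => ?_
    · obtain ⟨y, hy, hz⟩ := (hσ z).1 hz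
      exact (hl y hy).1.mem hz
    · obtain ⟨y, hy, hz⟩ := (hσ z).1 hz
      exact (hσ t).2 ⟨y, hy, (hl y hy).1.trans ht hz⟩
  -- The supremum `σ` may equal some of the levels, so `x ⊆ V_{6(σ+1)}` is what is guaranteed, and
  -- one more step makes `x` an element.
  refine ⟨succ (succ σ), hσo.succ.succ, ?_⟩
  have h₁ : six (succ σ) ε six (succ (succ σ)) := hσo.succ.succ.six_mem_six (by simp)
  refine (mem_V hσo.succ.succ.six).2 ⟨_, h₁, fun y hy => ?_⟩
  have h₂ : level y ε succ σ :=
    (hl y hy).1.mem_succ_of_sub hσo fun z hz => (hσ z).2 ⟨y, hy, hz⟩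
  exact V_mono hσo.succ.six (hσo.succ.six_mem_six h₂) y (hl y hy).2

end SetModel

end

noncomputable section

namespace SetModel

variable {M : Type} [memLang.Structure M] [Nonempty M] {ι κ : Type}

/-! ### Finite structures in a model -/

/-- `x` is a natural number. -/
def IsNat (x : M) : Prop := Ord x ∧ ∀ y, y ε x ∨ y = x → y = empty ∨ ∃ z, y = succ z

/-- `x` is finite. -/
def IsFin (x : M) : Prop :=
  ∃ k g, IsNat k ∧ FunOn g k ∧ (∀ y, y ε x ↔ ∃ i, pair i y ε g) ∧
    ∀ i j y, pair i y ε g ∧ pair j y ε g → i = j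

/-- `A = (D, R, F)` is a finite structure in which `(a, b) ∈ F` implies `(a, b, c) ∈ R`. -/
def Str (A D R F : M) : Prop :=
  A = triple D R F ∧ IsFin D ∧
  (∀ t, t ε R → ∃ a b c, a ε D ∧ b ε D ∧ c ε D ∧ t = triple a b c) ∧
  (∀ p, p ε F → ∃ a b, a ε D ∧ b ε D ∧ p = pair a b) ∧
  ∀ a b c, a ε D ∧ b ε D ∧ c ε D ∧ pair a b ε F → triple a b c ε R

/-- `(D', R', F')` neutrally extends `(D, R, F)` by the element `v`. -/
def NeutralExt (D R F D' R' F' v : M) : Prop :=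
  ¬ v ε D ∧ (∀ x, x ε D' ↔ x ε D ∨ x = v) ∧
  (∀ a b c, a ε D ∧ b ε D ∧ c ε D → (triple a b c ε R ↔ triple a b c ε R')) ∧
  (∀ a b, a ε D ∧ b ε D → (pair a b ε F ↔ pair a b ε F')) ∧
  ∀ x, x ε D' → ¬ pair x v ε F' ∧ ¬ pair v x ε F'

/-- `w` is the element by which the neutral extension `D'` of the structure on `D` is realized over
the relation `s` on `W`. -/
def Admissible (m W W' s D D' R' v w : M) : Prop :=
  ∃ A B R F F', Str A D R F ∧ Str B D' R' F' ∧ NeutralExt D R F D' R' F' v ∧ Sub D' W ∧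
    (∀ a b, a ε D ∧ b ε D → (a ε b ↔ pair a b ε F)) ∧
    (∀ a b c, a ε D ∧ b ε D ∧ c ε D → (triple a b c ε R ↔ triple a b c ε s)) ∧
    (∃ o q, o = addThree m ∧ q = pair A B ∧ w = pair o q) ∧ w ε W'

theorem Admissible.sub {m s D D' R' v w W W' : M} (h : Admissible m W W' s D D' R' v w) :
    Sub D W := by
  obtain ⟨A, B, R, F, F', -, -, hn, hW, -⟩ := h
  exact fun z hz => hW z ((hn.2.1 z).2 (.inl hz))

/-- `f(a) = x` for the map `f : D ∪ {v} → D ∪ {w}` that fixes `D` and maps `v` to `w`. -/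
def Image (D v w a x : M) : Prop := a ε D ∧ x = a ∨ a = v ∧ x = w

/-- The condition for a triple `(x, y, z)` of elements of `W'` to belong to the extension of the
relation `s` from `W` to `W'`. -/
def StepCond (m W W' s x y z : M) : Prop :=
  (x ε W ∧ y ε W ∧ z ε W ∧ triple x y z ε s) ∨
  (∃ D D' R' v w, Admissible m W W' s D D' R' v w ∧
    ∃ a b c, Image D v w a x ∧ Image D v w b y ∧ Image D v w c z ∧ triple a b c ε R') ∨
  ¬ (x ε W ∧ y ε W ∧ z ε W) ∧
    ¬ ∃ D D' R' v w, Admissible m W W' s D D' R' v w ∧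
      (x ε D ∨ x = w) ∧ (y ε D ∨ y = w) ∧ (z ε D ∨ z = w)

/-- `t` is a triple of elements of `W'` that satisfies `StepCond`. -/
def StepMem (m W W' s t : M) : Prop :=
  ∃ x y z, x ε W' ∧ y ε W' ∧ z ε W' ∧ t = triple x y z ∧ StepCond m W W' s x y z

/-- The relation `S_{α+1}` obtained from `s = S_α`. -/
def nextS (α s : M) : M :=
  -- All triples of elements of `V_{6α+6}` lie four levels higher, so separating from this set loses
  -- none.
  sep (V (succ (succ (succ (succ (addSix (six α)))))))
    (StepMem (six α) (V (six α)) (V (addSix (six α))) s)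

/-- The relation `S_α`. -/
def levelS (α : M) : M := recFun nextS α

/-- The union of the relations `S_α`. -/
def S (a b c : M) : Prop := ∃ α, Ord α ∧ triple a b c ε levelS α

variable [SetModel M]

/-! ### Definability of the construction of `S` -/

instance DefPred.isNat (s : (ι → M) → M) [DefFun s] : DefPred fun v => IsNat (s v) :=
  .subst₁ (by unfold IsNat; infer_instance) s

instance DefPred.isFin (s : (ι → M) → M) [DefFun s] : DefPred fun v => IsFin (s v) :=
  .subst₁ (by unfold IsFin; infer_instance) s

instance DefPred.str (s t r q : (ι → M) → M) [DefFun s] [DefFun t] [DefFun r] [DefFun q] :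
    DefPred fun v => Str (s v) (t v) (r v) (q v) :=
  .subst₄ (by unfold Str; infer_instance) s t r q

instance DefPred.neutralExt (t₀ t₁ t₂ t₃ t₄ t₅ t₆ : (ι → M) → M) [h₀ : DefFun t₀] [h₁ : DefFun t₁]
    [h₂ : DefFun t₂] [h₃ : DefFun t₃] [h₄ : DefFun t₄] [h₅ : DefFun t₅] [h₆ : DefFun t₆] :
    DefPred fun v => NeutralExt (t₀ v) (t₁ v) (t₂ v) (t₃ v) (t₄ v) (t₅ v) (t₆ v) :=
  DefPred.subst
    (P := fun w : Fin 7 → M => NeutralExt (w 0) (w 1) (w 2) (w 3) (w 4) (w 5) (w 6))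
    (by unfold NeutralExt; infer_instance) ![t₀, t₁, t₂, t₃, t₄, t₅, t₆]
    (by simp [Fin.forall_fin_succ, h₀, h₁, h₂, h₃, h₄, h₅, h₆])

instance DefPred.admissible (t₀ t₁ t₂ t₃ t₄ t₅ t₆ t₇ t₈ : (ι → M) → M) [h₀ : DefFun t₀]
    [h₁ : DefFun t₁] [h₂ : DefFun t₂] [h₃ : DefFun t₃] [h₄ : DefFun t₄] [h₅ : DefFun t₅]
    [h₆ : DefFun t₆] [h₇ : DefFun t₇] [h₈ : DefFun t₈] :
    DefPred fun v =>
      Admissible (t₀ v) (t₁ v) (t₂ v) (t₃ v) (t₄ v) (t₅ v) (t₆ v) (t₇ v) (t₈ v) :=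
  DefPred.subst
    (P := fun w : Fin 9 → M =>
      Admissible (w 0) (w 1) (w 2) (w 3) (w 4) (w 5) (w 6) (w 7) (w 8))
    (by unfold Admissible; infer_instance) ![t₀, t₁, t₂, t₃, t₄, t₅, t₆, t₇, t₈]
    (by simp [Fin.forall_fin_succ, h₀, h₁, h₂, h₃, h₄, h₅, h₆, h₇, h₈])

instance DefPred.image (t₀ t₁ t₂ t₃ t₄ : (ι → M) → M) [DefFun t₀] [DefFun t₁]
    [DefFun t₂] [DefFun t₃] [DefFun t₄] :
    DefPred fun v => Image (t₀ v) (t₁ v) (t₂ v) (t₃ v) (t₄ v) := by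
  unfold Image; infer_instance

set_option synthInstance.maxSize 1000 in
instance DefPred.stepCond (t₀ t₁ t₂ t₃ t₄ t₅ t₆ : (ι → M) → M) [h₀ : DefFun t₀] [h₁ : DefFun t₁]
    [h₂ : DefFun t₂] [h₃ : DefFun t₃] [h₄ : DefFun t₄] [h₅ : DefFun t₅] [h₆ : DefFun t₆] :
    DefPred fun v => StepCond (t₀ v) (t₁ v) (t₂ v) (t₃ v) (t₄ v) (t₅ v) (t₆ v) :=
  DefPred.subst
    (P := fun w : Fin 7 → M => StepCond (w 0) (w 1) (w 2) (w 3) (w 4) (w 5) (w 6))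
    (by unfold StepCond; infer_instance) ![t₀, t₁, t₂, t₃, t₄, t₅, t₆]
    (by simp [Fin.forall_fin_succ, h₀, h₁, h₂, h₃, h₄, h₅, h₆])

instance DefPred.stepMem (t₀ t₁ t₂ t₃ t₄ : (ι → M) → M) [h₀ : DefFun t₀] [h₁ : DefFun t₁]
    [h₂ : DefFun t₂] [h₃ : DefFun t₃] [h₄ : DefFun t₄] :
    DefPred fun v => StepMem (t₀ v) (t₁ v) (t₂ v) (t₃ v) (t₄ v) :=
  DefPred.subst (P := fun w : Fin 5 → M => StepMem (w 0) (w 1) (w 2) (w 3) (w 4))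
    (by unfold StepMem; infer_instance) ![t₀, t₁, t₂, t₃, t₄]
    (by simp [Fin.forall_fin_succ, h₀, h₁, h₂, h₃, h₄])

instance DefFun.nextS (s t : (ι → M) → M) [DefFun s] [DefFun t] :
    DefFun fun v => nextS (s v) (t v) :=
  .subst₂ (by unfold SetModel.nextS; infer_instance) s t

instance DefFun.levelS (s : (ι → M) → M) [DefFun s] : DefFun fun v => levelS (s v) := by
  unfold SetModel.levelS; infer_instance

end SetModel

end

noncomputable section

namespace SetModel

variable {M : Type} [memLang.Structure M] [Nonempty M] {ι κ : Type} [SetModel M]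

/-! ### Properties of the ternary relation -/

/-- If `w = (6α + 3, (A, B))` were in `V_{6α}`, so would be `6α + 3` and its element `6α`, but no
ordinal `γ` belongs to `V_γ`. -/
theorem Admissible.not_mem {α s D D' R' v w W W' : M} (hα : Ord α)
    (h : Admissible (six α) W W' s D D' R' v w) : ¬ w ε V (six α) := by
  obtain ⟨A, B, R, F, F', -, -, -, -, -, -, ⟨o, q, rfl, rfl, rfl⟩, -⟩ := h
  intro hw
  exact hα.six.not_mem_V
    (V_trans hα.six (fst_mem_of_pair_mem_V hα.six hw) (mem_addThree _))

theorem triple_mem_levelS_succ {α x y z : M} (hα : Ord α) : triple x y z ε levelS (succ α) ↔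
    (x ε V (six (succ α)) ∧ y ε V (six (succ α)) ∧ z ε V (six (succ α))) ∧
    StepCond (six α) (V (six α)) (V (six (succ α))) (levelS α) x y z := by
  rw [levelS, recFun_succ hα, nextS, mem_sep, six_succ hα]
  constructor
  · rintro ⟨-, x', y', z', hx, hy, hz, e, h⟩
    obtain ⟨rfl, rfl, rfl⟩ := triple_inj.1 e
    exact ⟨⟨hx, hy, hz⟩, h⟩
  · rintro ⟨⟨hx, hy, hz⟩, h⟩
    exact ⟨triple_mem_V hα.six.addSix hx hy hz, x, y, z, hx, hy, hz, rfl, h⟩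

theorem mem_levelS_limit {α t : M} (hα : Limit α) :
    t ε levelS α ↔ ∃ β, β ε α ∧ t ε levelS β :=
  mem_recFun_limit hα

theorem levelS_empty : levelS (empty : M) = empty := recFun_empty

theorem V_six_mono {α β : M} (hα : Ord α) (h : β ε succ α) : Sub (V (six β)) (V (six α)) := by
  rcases mem_succ.1 h with h | rfl
  · exact V_mono hα.six (hα.six_mem_six h)
  · exact fun _ h => h

theorem mem_V_six_limit {α x : M} (hα : Limit α) :
    x ε V (six α) ↔ ∃ β, β ε α ∧ x ε V (six β) := by
  constructor
  · intro h
    obtain ⟨δ, hδ, h⟩ := (mem_V hα.1.six).1 h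
    obtain ⟨β, hβ, hδ⟩ := (mem_six_limit hα).1 hδ
    exact ⟨β, hβ, (mem_V (hα.1.mem hβ).six).2 ⟨δ, hδ, h⟩⟩
  · rintro ⟨β, hβ, h⟩
    exact V_six_mono hα.1 (mem_succ.2 (.inl hβ)) x h

theorem exists_mem_V_six_of_limit₂ {α x y : M} (hα : Limit α) (hx : x ε V (six α))
    (hy : y ε V (six α)) : ∃ β, β ε α ∧ x ε V (six β) ∧ y ε V (six β) := by
  obtain ⟨β, hβ, hx⟩ := (mem_V_six_limit hα).1 hx
  obtain ⟨γ, hγ, hy⟩ := (mem_V_six_limit hα).1 hy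
  have hβ' := hα.1.mem hβ
  have hγ' := hα.1.mem hγ
  rcases hβ'.trichotomy hγ' with h | rfl | h
  · exact ⟨γ, hγ, V_six_mono hγ' (mem_succ.2 (.inl h)) x hx, hy⟩
  · exact ⟨β, hβ, hx, hy⟩
  · exact ⟨β, hβ, hx, V_six_mono hβ' (mem_succ.2 (.inl h)) y hy⟩

theorem exists_mem_V_six_of_limit₃ {α x y z : M} (hα : Limit α) (hx : x ε V (six α))
    (hy : y ε V (six α)) (hz : z ε V (six α)) :
    ∃ β, β ε α ∧ x ε V (six β) ∧ y ε V (six β) ∧ z ε V (six β) := by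
  obtain ⟨β, hβ, hx, hy⟩ := exists_mem_V_six_of_limit₂ hα hx hy
  obtain ⟨γ, hγ, hz⟩ := (mem_V_six_limit hα).1 hz
  have hβ' := hα.1.mem hβ
  have hγ' := hα.1.mem hγ
  rcases hβ'.trichotomy hγ' with h | rfl | h
  · have := V_six_mono hγ' (mem_succ.2 (.inl h))
    exact ⟨γ, hγ, this x hx, this y hy, hz⟩
  · exact ⟨β, hβ, hx, hy, hz⟩
  · exact ⟨β, hβ, hx, hy, V_six_mono hβ' (mem_succ.2 (.inl h)) z hz⟩

/-- `S_α` contains all triples `(x, y, z)` of elements of `V_{6α}` with `x ∈ y`. -/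
theorem triple_mem_levelS_of_mem {α x y z : M} (hα : Ord α) (hx : x ε V (six α))
    (hy : y ε V (six α)) (hz : z ε V (six α)) (hxy : x ε y) : triple x y z ε levelS α := by
  refine limit_ord_induction (fun α => ∀ x y z, x ε V (six α) → y ε V (six α) → z ε V (six α) →
    x ε y → triple x y z ε levelS α) ?_ ?_ ?_ hα x y z hx hy hz hxy
  · intro x y z hx
    rw [six_empty, V_empty] at hx
    exact (not_mem_empty x hx).elim
  · intro α hα ih x y z hx hy hz hxy
    refine (triple_mem_levelS_succ hα).2 ⟨⟨hx, hy, hz⟩, ?_⟩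
    by_cases hW : x ε V (six α) ∧ y ε V (six α) ∧ z ε V (six α)
    · exact .inl ⟨hW.1, hW.2.1, hW.2.2, ih x y z hW.1 hW.2.1 hW.2.2 hxy⟩
    refine .inr ?_
    by_cases hex : ∃ D D' R' v w, Admissible (six α) (V (six α)) (V (six (succ α))) (levelS α)
      D D' R' v w ∧ (x ε D ∨ x = w) ∧ (y ε D ∨ y = w) ∧ (z ε D ∨ z = w)
    swap
    · exact .inr ⟨hW, hex⟩
    refine .inl ?_
    obtain ⟨D, D', R', v, w, hA, hxDw, hyDw, hzD⟩ := hex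
    have hw := hA.not_mem hα
    have hD := hA.sub
    have hyD : y ε D := by
      rcases hyDw with h | rfl
      · exact h
      -- Suppose `y = w`. Its members `{6α + 3}` and `{6α + 3, (A, B)}` both contain `6α + 3`, so
      -- neither is in `V_{6α}`; and `x = w` would give `w ∈ w`.
      exfalso
      rcases hxDw with h | rfl
      · obtain ⟨A, B, R, F, F', -, -, -, -, -, -, ⟨o, q, rfl, rfl, rfl⟩, -⟩ := hA
        have : addThree (six α) ε x := by
          rcases mem_upair.1 hxy with rfl | rfl <;> simp
        exact hα.six.not_mem_V (V_trans hα.six (V_trans hα.six (hD x h) this) (mem_addThree _))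
      · exact mem_irrefl _ hxy
    have hxD : x ε D := by
      rcases hxDw with h | rfl
      · exact h
      · exact (hw (V_trans hα.six (hD y hyD) hxy)).elim
    refine ⟨D, D', R', v, w, hA, x, y, ?_⟩
    obtain ⟨A, B, R, F, F', hA, hB, hn, hW', hE, -⟩ := hA
    -- As `A` is `∈`-absolute, `x ∈^B y` holds, and so `S^B(x, y, c)` holds for every `c` in `B`,
    -- including `v`.
    have hF := (hn.2.2.2.1 x y ⟨hxD, hyD⟩).1 ((hE x y ⟨hxD, hyD⟩).1 hxy)
    have hsub (u : M) (hu : u ε D) : u ε D' := (hn.2.1 u).2 (.inl hu)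
    rcases hzD with hzD | rfl
    · exact ⟨z, .inl ⟨hxD, rfl⟩, .inl ⟨hyD, rfl⟩, .inl ⟨hzD, rfl⟩,
        hB.2.2.2.2 x y z ⟨hsub x hxD, hsub y hyD, hsub z hzD, hF⟩⟩
    · exact ⟨v, .inl ⟨hxD, rfl⟩, .inl ⟨hyD, rfl⟩, .inr ⟨rfl, rfl⟩,
        hB.2.2.2.2 x y v ⟨hsub x hxD, hsub y hyD, (hn.2.1 v).2 (.inr rfl), hF⟩⟩
  · intro α hα ih x y z hx hy hz hxy
    obtain ⟨β, hβ, hx, hy, hz⟩ := exists_mem_V_six_of_limit₃ hα hx hy hz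
    exact (mem_levelS_limit hα).2 ⟨β, hβ, ih β hβ x y z hx hy hz hxy⟩

/-! ### Coherence of the relations `S_α` -/

theorem mem_V_six_of_triple_mem {α x y z : M} (hα : Ord α) (h : triple x y z ε levelS α) :
    x ε V (six α) ∧ y ε V (six α) ∧ z ε V (six α) := by
  refine limit_ord_induction (fun α => ∀ x y z, triple x y z ε levelS α →
    x ε V (six α) ∧ y ε V (six α) ∧ z ε V (six α)) ?_ ?_ ?_ hα x y z h
  · intro x y z h
    rw [levelS_empty] at h
    exact (not_mem_empty _ h).elim
  · exact fun α hα _ x y z h => ((triple_mem_levelS_succ hα).1 h).1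
  · intro α hα ih x y z h
    obtain ⟨β, hβ, h⟩ := (mem_levelS_limit hα).1 h
    have hs := V_six_mono hα.1 (mem_succ.2 (.inl hβ))
    obtain ⟨hx, hy, hz⟩ := ih β hβ x y z h
    exact ⟨hs x hx, hs y hy, hs z hz⟩

/-- A triple from `V_{6α}` in the range of some `f_{α,A,B}` avoids `w`, so it lies in `A`, where
`S^B` restricts to `S_α`. The default clause applies to new triples only. -/
theorem triple_mem_levelS_succ_iff {α x y z : M} (hα : Ord α) (hx : x ε V (six α))
    (hy : y ε V (six α)) (hz : z ε V (six α)) :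
    triple x y z ε levelS (succ α) ↔ triple x y z ε levelS α := by
  rw [triple_mem_levelS_succ hα]
  constructor
  · rintro ⟨-, h | ⟨D, D', R', v, w, hA, a, b, c, ha, hb, hc, h⟩ | h⟩
    · exact h.2.2.2
    · have hw := hA.not_mem hα
      have key (a x : M) (hx : x ε V (six α)) (h : Image D v w a x) : x ε D ∧ a = x := by
        rcases h with ⟨h, rfl⟩ | ⟨-, rfl⟩
        · exact ⟨h, rfl⟩
        · exact (hw hx).elim
      obtain ⟨hxD, rfl⟩ := key a x hx ha
      obtain ⟨hyD, rfl⟩ := key b y hy hb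
      obtain ⟨hzD, rfl⟩ := key c z hz hc
      obtain ⟨A, B, R, F, F', -, -, hn, -, -, hs, -⟩ := hA
      exact (hs _ _ _ ⟨hxD, hyD, hzD⟩).1 ((hn.2.2.1 _ _ _ ⟨hxD, hyD, hzD⟩).2 h)
    · exact (h.1 ⟨hx, hy, hz⟩).elim
  · intro h
    have hs := V_six_mono hα.succ (β := α) (by simp)
    exact ⟨⟨hs x hx, hs y hy, hs z hz⟩, .inl ⟨hx, hy, hz, h⟩⟩

theorem levelS_coherent {α β x y z : M} (hα : Ord α) (hβ : β ε α) (hx : x ε V (six β))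
    (hy : y ε V (six β)) (hz : z ε V (six β)) :
    triple x y z ε levelS α ↔ triple x y z ε levelS β := by
  refine limit_ord_induction (fun α => ∀ β, β ε α → ∀ x y z, x ε V (six β) → y ε V (six β) →
    z ε V (six β) → (triple x y z ε levelS α ↔ triple x y z ε levelS β)) ?_ ?_ ?_
    hα β hβ x y z hx hy hz
  · exact fun β hβ => (not_mem_empty β hβ).elim
  · intro α hα ih β hβ x y z hx hy hz
    have hs := V_six_mono hα hβ
    rw [triple_mem_levelS_succ_iff hα (hs x hx) (hs y hy) (hs z hz)]
    rcases mem_succ.1 hβ with hβ | rfl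
    · exact ih β hβ x y z hx hy hz
    · rfl
  · intro α hα ih β hβ x y z hx hy hz
    rw [mem_levelS_limit hα]
    refine ⟨?_, fun h => ⟨β, hβ, h⟩⟩
    rintro ⟨δ, hδ, h⟩
    rcases (hα.1.mem hδ).trichotomy (hα.1.mem hβ) with hd | rfl | hd
    · obtain ⟨hx', hy', hz'⟩ := mem_V_six_of_triple_mem (hα.1.mem hδ) h
      exact (ih β hβ δ hd x y z hx' hy' hz').2 h
    · exact h
    · exact (ih δ hδ β hd x y z hx hy hz).1 h

/-- By coherence, `S` may be evaluated at any level that contains the three arguments. -/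
theorem S_iff_triple_mem {α x y z : M} (hα : Ord α) (hx : x ε V (six α)) (hy : y ε V (six α))
    (hz : z ε V (six α)) : S x y z ↔ triple x y z ε levelS α := by
  refine ⟨?_, fun h => ⟨α, hα, h⟩⟩
  rintro ⟨δ, hδ, h⟩
  rcases hδ.trichotomy hα with hd | rfl | hd
  · obtain ⟨hx', hy', hz'⟩ := mem_V_six_of_triple_mem hδ h
    exact (levelS_coherent hα hd hx' hy' hz').2 h
  · exact h
  · exact (levelS_coherent hδ hd hx hy hz).1 h

theorem S_of_mem {x y : M} (h : x ε y) (z : M) : S x y z := by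
  -- The set `{{x, y}, z}` serves only to find one level containing `x`, `y` and `z`.
  obtain ⟨α, hα, ht⟩ := exists_mem_V_six (upair (upair x y) z)
  have h₁ : upair x y ε V (six α) := V_trans hα.six ht (by simp)
  exact ⟨α, hα, triple_mem_levelS_of_mem hα (V_trans hα.six h₁ (by simp))
    (V_trans hα.six h₁ (by simp)) (V_trans hα.six ht (by simp)) h⟩

/-! ### Finite sets -/

theorem isNat_empty : IsNat (empty : M) :=
  ⟨ord_empty, fun y hy => .inl (hy.resolve_left (not_mem_empty y))⟩

theorem IsNat.succ {k : M} (hk : IsNat k) : IsNat (succ k) := by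
  refine ⟨hk.1.succ, fun y hy => ?_⟩
  rcases hy with hy | hy
  · exact hk.2 y (mem_succ.1 hy)
  · exact .inr ⟨k, hy⟩

theorem isFin_empty : IsFin (empty : M) := by
  refine ⟨empty, empty, isNat_empty, ⟨?_, ?_⟩, ?_, ?_⟩ <;> simp

/-- If `v` is new, an enumeration indexed by `k` is extended by the pair `(k, v)`. -/
theorem IsFin.insert {a : M} (ha : IsFin a) (v : M) : IsFin (cup a (upair v v)) := by
  by_cases hv : v ε a
  · have : cup a (upair v v) = a := ext _ _ fun z => by
      simp only [mem_cup, mem_upair, or_self]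
      exact or_iff_left_of_imp fun h => h ▸ hv
    rwa [this]
  obtain ⟨k, g, hk, hg, ha, hi⟩ := ha
  have hgk (i y : M) (h : pair i y ε g) : i ε k := by
    obtain ⟨i', y', hi', e⟩ := hg.1 _ h
    rw [(pair_inj.1 e).1]
    exact hi'
  have hm (i y : M) : pair i y ε cup g (upair (pair k v) (pair k v)) ↔
    pair i y ε g ∨ (i = k ∧ y = v) := by simp
  refine ⟨succ k, cup g (upair (pair k v) (pair k v)), hk.succ, ⟨fun p hp => ?_, fun x hx => ?_⟩,
    fun y => ?_, ?_⟩
  · simp only [mem_cup, mem_upair, or_self] at hp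
    rcases hp with hp | rfl
    · obtain ⟨x, y, hx, e⟩ := hg.1 p hp
      exact ⟨x, y, mem_succ.2 (.inl hx), e⟩
    · exact ⟨k, v, by simp, rfl⟩
  · rcases mem_succ.1 hx with hx | rfl
    · obtain ⟨y, hy, hy'⟩ := hg.2 x hx
      refine ⟨y, (hm x y).2 (.inl hy), fun z hz => ?_⟩
      rcases (hm x z).1 hz with h | ⟨rfl, -⟩
      · exact hy' z h
      · exact (mem_irrefl _ hx).elim
    · refine ⟨v, (hm x v).2 (.inr ⟨rfl, rfl⟩), fun z hz => ?_⟩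
      rcases (hm x z).1 hz with h | h
      · exact (mem_irrefl _ (hgk x z h)).elim
      · exact h.2
  · simp only [mem_cup, mem_upair, or_self, ha, hm, exists_or]
    simp
  · rintro i j y ⟨h₁, h₂⟩
    rcases (hm i y).1 h₁ with h₁ | ⟨ei, ey⟩ <;> rcases (hm j y).1 h₂ with h₂ | ⟨ej, ey'⟩
    · exact hi i j y ⟨h₁, h₂⟩
    · exact (hv ((ha v).2 ⟨i, ey' ▸ h₁⟩)).elim
    · exact (hv ((ha v).2 ⟨j, ey ▸ h₂⟩)).elim
    · rw [ei, ej]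

theorem isFin_upair (x y : M) : IsFin (upair x y) := by
  have : upair x y = cup (cup empty (upair x x)) (upair y y) := ext _ _ fun z => by simp
  rw [this]
  exact (isFin_empty.insert x).insert y

/-- If `x ∉ y`, the structure on `{x, y}` has a neutral extension in which `S(x, y, v)` fails. -/
theorem exists_admissible {x y : M} (hxy : ¬ x ε y) :
    ∃ α D D' R' v w, Ord α ∧ x ε D ∧ y ε D ∧ ¬ triple x y v ε R' ∧
      Admissible (six α) (V (six α)) (V (six (succ α))) (levelS α) D D' R' v w := by
  obtain ⟨β, hβ, hv⟩ := exists_mem_V_six (upair x y)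
  have hn := hβ.six
  have hα := hβ.succ.succ
  set n := six β with hn_def
  -- Thus `6α = n + 12`, which leaves room for the code `(A, B)` inside `V_{6α}`.
  set α := succ (succ β) with hα_def
  have hm : six α = addSix (addSix n) := by rw [hα_def, six_succ hβ.succ, six_succ hβ]
  have hm' : six (succ α) = addSix (six α) := six_succ hα
  -- The set `{x, y}` is both the domain of `A` and the added point: it is not an element of itself.
  set v := upair x y with hv_def
  set D' := cup v (upair v v) with hD'_def
  have hvv : ¬ v ε v := mem_irrefl v
  have hDn : Sub v (V n) := fun z hz => V_trans hn hv hz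
  have hDD' (z : M) (hz : z ε v) : z ε D' := mem_cup.2 (.inl hz)
  have hvD' : v ε D' := by simp [hD'_def]
  have hD'n : Sub D' (V n) := fun z hz => by
    simp only [hD'_def, mem_cup, mem_upair, or_self] at hz
    rcases hz with hz | rfl
    · exact hDn z hz
    · exact hv
  have hD'c (z : M) : z ε D' ↔ z ε v ∨ z = v := by simp [hD'_def]
  have hnα : Sub (V n) (V (six α)) :=
    V_six_mono hα (by simp [hα_def])
  -- `R` and `F` are `S_α` and `∈` on `{x, y}`. `R'` adds to `R` the triples `(a, b, v)` with `a ∈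
  -- b`, the fewest that the structure condition permits. `F` also serves for `B`, since `v` is
  -- neutral.
  let R := sep (V (succ (succ (succ (succ n))))) fun t => ∃ a b c,
    a ε v ∧ b ε v ∧ c ε v ∧ t = triple a b c ∧ t ε levelS α
  let F := sep (V (succ (succ n))) fun p => ∃ a b, a ε v ∧ b ε v ∧ p = pair a b ∧ a ε b
  let R' := sep (V (succ (succ (succ (succ n))))) fun t => ∃ a b c,
    a ε v ∧ b ε v ∧ t = triple a b c ∧ (c ε v ∧ t ε levelS α ∨ c = v ∧ a ε b)
  have hR (t : M) : t ε R ↔ t ε V (succ (succ (succ (succ n)))) ∧ ∃ a b c,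
    a ε v ∧ b ε v ∧ c ε v ∧ t = triple a b c ∧ t ε levelS α := mem_sep _
  have hF (p : M) : p ε F ↔ p ε V (succ (succ n)) ∧
    ∃ a b, a ε v ∧ b ε v ∧ p = pair a b ∧ a ε b := mem_sep _
  have hR' (t : M) : t ε R' ↔ t ε V (succ (succ (succ (succ n)))) ∧ ∃ a b c,
    a ε v ∧ b ε v ∧ t = triple a b c ∧ (c ε v ∧ t ε levelS α ∨ c = v ∧ a ε b) := mem_sep _
  have hRt (a b c : M) : triple a b c ε R ↔
      a ε v ∧ b ε v ∧ c ε v ∧ triple a b c ε levelS α := by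
    rw [hR]
    constructor
    · rintro ⟨-, a', b', c', ha, hb, hc, e, h⟩
      obtain ⟨rfl, rfl, rfl⟩ := triple_inj.1 e
      exact ⟨ha, hb, hc, h⟩
    · rintro ⟨ha, hb, hc, h⟩
      exact ⟨triple_mem_V hn (hDn a ha) (hDn b hb) (hDn c hc), a, b, c, ha, hb, hc, rfl, h⟩
  have hFp (a b : M) : pair a b ε F ↔ a ε v ∧ b ε v ∧ a ε b := by
    rw [hF]
    constructor
    · rintro ⟨-, a', b', ha, hb, e, h⟩
      obtain ⟨rfl, rfl⟩ := pair_inj.1 e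
      exact ⟨ha, hb, h⟩
    · rintro ⟨ha, hb, h⟩
      exact ⟨pair_mem_V hn (hDn a ha) (hDn b hb), a, b, ha, hb, rfl, h⟩
  have hR't (a b c : M) : triple a b c ε R' ↔
      a ε v ∧ b ε v ∧ (c ε v ∧ triple a b c ε levelS α ∨ c = v ∧ a ε b) := by
    rw [hR']
    constructor
    · rintro ⟨-, a', b', c', ha, hb, e, h⟩
      obtain ⟨rfl, rfl, rfl⟩ := triple_inj.1 e
      exact ⟨ha, hb, h⟩
    · rintro ⟨ha, hb, h⟩
      refine ⟨triple_mem_V hn (hDn a ha) (hDn b hb) (hD'n c ?_), a, b, c, ha, hb, rfl, h⟩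
      rcases h with h | h
      · exact hDD' c h.1
      · rw [h.1]
        exact hvD'
  have hup {γ : M} (hγ : Ord γ) {z : M} (hz : z ε V γ) : z ε V (succ γ) := V_mono_succ hγ z hz
  have hn₅ := hn.succ.succ.succ.succ.succ
  have hRV : R ε V (succ (succ (succ (succ (succ n))))) :=
    (mem_V_succ hn.succ.succ.succ.succ).2 fun z hz => ((hR z).1 hz).1
  have hR'V : R' ε V (succ (succ (succ (succ (succ n))))) :=
    (mem_V_succ hn.succ.succ.succ.succ).2 fun z hz => ((hR' z).1 hz).1
  have hFV : F ε V (succ (succ (succ (succ (succ n))))) :=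
    hup hn.succ.succ.succ.succ <| hup hn.succ.succ.succ <|
      (mem_V_succ hn.succ.succ).2 fun z hz => ((hF z).1 hz).1
  have hDV : v ε V (succ (succ (succ (succ (succ n))))) :=
    hup hn.succ.succ.succ.succ <| hup hn.succ.succ.succ <| hup hn.succ.succ <| hup hn.succ <|
      hup hn hv
  have hD'V : D' ε V (succ (succ (succ (succ (succ n))))) :=
    hup hn.succ.succ.succ.succ <| hup hn.succ.succ.succ <| hup hn.succ.succ <| hup hn.succ <|
      (mem_V_succ hn).2 hD'n
  -- The components lie in `V_{n+5}`, the triples `A` and `B` in `V_{n+9}`, and their pair in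
  -- `V_{n+11}`.
  have hAB : pair (triple v R F) (triple D' R' F) ε V (six α) := by
    rw [hm]
    exact hup hn₅.succ.succ.succ.succ.succ.succ <| pair_mem_V hn₅.succ.succ.succ.succ
      (triple_mem_V hn₅ hDV hRV hFV) (triple_mem_V hn₅ hD'V hR'V hFV)
  -- Since `6α + 3` first appears in `V_{6α+4}`, the pair lands in `V_{6α+6}`.
  have hw : pair (addThree (six α)) (pair (triple v R F) (triple D' R' F)) ε V (six (succ α)) := by
    rw [hm']
    exact pair_mem_V hα.six.addThree.succ hα.six.addThree.mem_V_succ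
      (hup hα.six.addThree <| hup hα.six.succ.succ <| hup hα.six.succ <| hup hα.six hAB)
  refine ⟨α, v, D', R', v, _, hα, by simp [hv_def], by simp [hv_def], ?_,
    triple v R F, triple D' R' F, R, F, F, ⟨rfl, isFin_upair x y, ?_, ?_, ?_⟩,
    ⟨rfl, (isFin_upair x y).insert v, ?_, ?_, ?_⟩, ⟨hvv, hD'c, ?_, fun a b _ => Iff.rfl, ?_⟩,
    fun z hz => hnα z (hD'n z hz), ?_, ?_, ⟨_, _, rfl, rfl, rfl⟩, hw⟩
  · rw [hR't]
    rintro ⟨-, -, h | h⟩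
    · exact hvv h.1
    · exact hxy h.2
  · intro t ht
    obtain ⟨-, a, b, c, ha, hb, hc, e, -⟩ := (hR t).1 ht
    exact ⟨a, b, c, ha, hb, hc, e⟩
  · intro p hp
    obtain ⟨-, a, b, ha, hb, e, -⟩ := (hF p).1 hp
    exact ⟨a, b, ha, hb, e⟩
  · rintro a b c ⟨ha, hb, hc, h⟩
    exact (hRt a b c).2 ⟨ha, hb, hc, triple_mem_levelS_of_mem hα (hnα a (hDn a ha))
      (hnα b (hDn b hb)) (hnα c (hDn c hc)) ((hFp a b).1 h).2.2⟩
  · intro t ht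
    obtain ⟨-, a, b, c, ha, hb, e, h⟩ := (hR' t).1 ht
    exact ⟨a, b, c, hDD' a ha, hDD' b hb, (hD'c c).2 (h.imp And.left And.left), e⟩
  · intro p hp
    obtain ⟨-, a, b, ha, hb, e, -⟩ := (hF p).1 hp
    exact ⟨a, b, hDD' a ha, hDD' b hb, e⟩
  · rintro a b c ⟨-, -, hc, h⟩
    obtain ⟨ha, hb, hab⟩ := (hFp a b).1 h
    refine (hR't a b c).2 ⟨ha, hb, ?_⟩
    rcases (hD'c c).1 hc with hc | hc
    · exact .inl ⟨hc, triple_mem_levelS_of_mem hα (hnα a (hDn a ha))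
        (hnα b (hDn b hb)) (hnα c (hDn c hc)) hab⟩
    · exact .inr ⟨hc, hab⟩
  · rintro a b c ⟨ha, hb, hc⟩
    rw [hRt, hR't]
    refine ⟨fun h => ⟨ha, hb, .inl h.2.2⟩, fun h => ⟨ha, hb, hc, ?_⟩⟩
    rcases h.2.2 with h | h
    · exact h.2
    · exact (hvv (h.1 ▸ hc)).elim
  · refine fun z _ => ⟨fun h => hvv ((hFp _ _).1 h).2.1, fun h => hvv ((hFp _ _).1 h).1⟩
  · rintro a b ⟨ha, hb⟩
    simp [hFp, ha, hb]
  · rintro a b c ⟨ha, hb, hc⟩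
    simp [hRt, ha, hb, hc]

/-- The pair `w` determines `A` and `B`, and `v` is the only element of `D'` outside `D`. -/
theorem Admissible.unique {m W W' s D D' R' v D₁ D₁' R₁' v₁ w : M}
    (h : Admissible m W W' s D D' R' v w) (h₁ : Admissible m W W' s D₁ D₁' R₁' v₁ w) :
    D₁ = D ∧ R₁' = R' ∧ v₁ = v := by
  obtain ⟨A, B, R, F, F', hA, hB, hn, -, -, -, ⟨o, q, rfl, rfl, rfl⟩, -⟩ := h
  obtain ⟨A₁, B₁, R₁, F₁, F₁', hA₁, hB₁, hn₁, -, -, -, ⟨o, q, rfl, rfl, e⟩, -⟩ := h₁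
  simp only [pair_inj, true_and, hA.1, hB.1, hA₁.1, hB₁.1, triple_inj] at e
  obtain ⟨⟨rfl, -, -⟩, rfl, rfl, -⟩ := e
  refine ⟨rfl, rfl, ?_⟩
  rcases (hn.2.1 v₁).1 ((hn₁.2.1 v₁).2 (.inr rfl)) with h | h
  · exact (hn₁.1 h).elim
  · exact h

theorem exists_not_S {x y : M} (hxy : ¬ x ε y) : ∃ z, ¬ S x y z := by
  obtain ⟨α, D, D', R', v, w, hα, hx, hy, hR', hA⟩ := exists_admissible hxy
  have hw := hA.not_mem hα
  have hD := hA.sub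
  have hs := V_six_mono hα.succ (β := α) (by simp)
  have hw' : w ε V (six (succ α)) := by
    obtain ⟨A, B, R, F, F', -, -, -, -, -, -, -, h⟩ := hA
    exact h
  refine ⟨w, ?_⟩
  rw [S_iff_triple_mem hα.succ (hs x (hD x hx)) (hs y (hD y hy)) hw', triple_mem_levelS_succ hα]
  -- None of the three clauses admits `(x, y, w)`: `w` is not old; an extension with `w` in its
  -- range is the chosen one, where `S^B(x, y, v)` fails; and the default clause is blocked because
  -- `x`, `y`, `w` lie in one range.
  rintro ⟨-, h | ⟨D₁, D₁', R₁', v₁, w₁, hA₁, a, b, c, ha, hb, hc, h⟩ | h⟩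
  · exact hw h.2.2.1
  · have hD₁ := hA₁.sub
    have hw₁ := hA₁.not_mem hα
    have key (a x : M) (hx : x ε D) (h : Image D₁ v₁ w₁ a x) : a = x := by
      rcases h with ⟨-, rfl⟩ | ⟨-, rfl⟩
      · rfl
      · exact (hw₁ (hD _ hx)).elim
    obtain rfl := key a x hx ha
    obtain rfl := key b y hy hb
    rcases hc with ⟨hc, rfl⟩ | ⟨rfl, rfl⟩
    · exact hw (hD₁ _ hc)
    · obtain ⟨rfl, rfl, rfl⟩ := hA.unique hA₁
      exact hR' h
  · exact h.2 ⟨D, D', R', v, w, hA, .inl hx, .inl hy, .inr rfl⟩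

theorem mem_iff_forall_S {x y : M} : x ε y ↔ ∀ z, S x y z := by
  refine ⟨S_of_mem, fun h => ?_⟩
  by_contra hxy
  obtain ⟨z, hz⟩ := exists_not_S hxy
  exact hz (h z)

end SetModel

end

/-! ### The meaning of the formulas of set theory in a model -/

namespace SetFormula

open SetModel

variable {M : Type} [memLang.Structure M] {n : ℕ} {e : Empty → M} {v : Fin n → M}

@[simp] theorem realize_mem (x y : Fin n) : (mem x y).Realize e v ↔ v x ε v y := by
  simp [mem, E, BoundedFormula.realize_rel₂]

@[simp] theorem realize_eq (x y : Fin n) : (eq x y).Realize e v ↔ v x = v y := by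
  simp [eq]

@[simp] theorem realize_neg (φ : Fml n) : (neg φ).Realize e v ↔ ¬ φ.Realize e v := by
  simp [neg]

@[simp] theorem realize_and (φ ψ : Fml n) :
    (SetFormula.and φ ψ).Realize e v ↔ φ.Realize e v ∧ ψ.Realize e v := by
  simp [SetFormula.and]

@[simp] theorem realize_or (φ ψ : Fml n) :
    (SetFormula.or φ ψ).Realize e v ↔ φ.Realize e v ∨ ψ.Realize e v := by
  simp [SetFormula.or]

@[simp] theorem realize_imp (φ ψ : Fml n) :
    (imp φ ψ).Realize e v ↔ (φ.Realize e v → ψ.Realize e v) := by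
  simp [imp]

@[simp] theorem realize_iff (φ ψ : Fml n) :
    (iff φ ψ).Realize e v ↔ (φ.Realize e v ↔ ψ.Realize e v) := by
  simp [iff]

@[simp] theorem realize_all (φ : Fin (n + 1) → Fml (n + 1)) :
    (all φ).Realize e v ↔ ∀ a, (φ (Fin.last n)).Realize e (Fin.snoc v a) := by
  simp [all]

@[simp] theorem realize_ex (φ : Fin (n + 1) → Fml (n + 1)) :
    (ex φ).Realize e v ↔ ∃ a, (φ (Fin.last n)).Realize e (Fin.snoc v a) := by
  simp [ex]

@[simp] theorem realize_sub (x y : Fin n) : (sub x y).Realize e v ↔ SetModel.Sub (v x) (v y) := by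
  simp [sub, SetModel.Sub]

@[simp] theorem realize_trans (x : Fin n) : (trans x).Realize e v ↔ SetModel.Trans (v x) := by
  simp [trans, SetModel.Trans]

@[simp] theorem realize_isOrd (x : Fin n) : (isOrd x).Realize e v ↔ SetModel.Ord (v x) := by
  simp [isOrd, SetModel.Ord]

@[simp] theorem realize_isImage (D x w a b : Fin n) :
    (isImage D x w a b).Realize e v ↔ Image (v D) (v x) (v w) (v a) (v b) := by
  simp [isImage, Image]

@[simp] theorem realize_inst {k m : ℕ} (φ : memLang.Formula (Fin k ⊕ Fin m)) (p : Fin k → Fin n)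
    (y : Fin m → Fin n) :
    (inst φ p y).Realize e v ↔ φ.Realize (Sum.elim (v ∘ p) (v ∘ y)) := by
  rw [inst, BoundedFormula.realize_relabel, Formula.Realize]
  refine iff_of_eq (congrArg₂ _ (funext fun i => ?_) (Subsingleton.elim _ _))
  rcases i with i | i <;> rfl

/-- A predicate definable with parameters uses finitely many of them, and these instantiate the
universally closed parameters of the separation and replacement axioms. -/
theorem setModel_of_models [h : M ⊨ ZFMinusInfPlus] : SetModel M := by
  have ax {φ : memLang.Sentence} (hφ : ZFMinusInfPlusAxiom φ) : M ⊨ φ :=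
    Theory.realize_sentence_of_mem ZFMinusInfPlus hφ
  have h₁ := ax .extensionality
  have h₂ := ax .pairing
  have h₃ := ax .union
  have h₄ := ax .powerSet
  have h₅ := ax .regularity
  have h₆ := ax .transitiveClosure
  simp only [Sentence.Realize, Formula.Realize, extensionality, pairing, union, powerSet,
    regularity, transitiveClosure, realize_all, realize_ex, realize_imp, realize_iff, realize_mem,
    realize_eq, realize_and, realize_or, realize_neg, realize_sub, realize_trans, Fin.snoc_last,
    Fin.snoc_castSucc] at h₁ h₂ h₃ h₄ h₅ h₆
  refine ⟨h₁, h₂, h₃, h₄, h₅, fun P hP a => ?_, fun R hR a ha => ?_, h₆⟩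
  · obtain ⟨k, φ, p, hφ⟩ := (hP.comap (κ := Fin 1) fun _ => Sum.inr 0).exists_params
    have h := BoundedFormula.realize_alls.1 (ax (.separation φ)) p
    simp only [realize_all, realize_ex, realize_iff, realize_mem, realize_and, realize_inst,
      Fin.snoc_last, Fin.snoc_castSucc] at h
    obtain ⟨b, hb⟩ := h a
    refine ⟨b, fun x => (hb x).trans (and_congr_right fun _ => ?_)⟩
    refine Iff.trans (iff_of_eq (congrArg _ (congrArg₂ _ ?_ ?_))) (hφ fun _ => x)
    · funext i
      change Fin.snoc _ _ i.castSucc.castSucc.castSucc = _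
      simp only [Fin.snoc_castSucc]
    · funext i
      fin_cases i
      simp
  · obtain ⟨k, φ, p, hφ⟩ := hR.exists_params
    have h := BoundedFormula.realize_alls.1 (ax (.replacement φ)) p
    simp only [realize_all, realize_ex, realize_iff, realize_mem, realize_and, realize_inst,
      Fin.snoc_last, Fin.snoc_castSucc, realize_imp, realize_eq] at h
    have hp (a b c d : M) : Fin.snoc (α := fun _ => M) (Fin.snoc (α := fun _ => M)
        (Fin.snoc (α := fun _ => M) (Fin.snoc (α := fun _ => M) p a) b) c) d ∘ Fin.castAdd 4 = p := by
      funext i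
      change Fin.snoc _ _ i.castSucc.castSucc.castSucc.castSucc = _
      simp only [Fin.snoc_castSucc]
    simp only [hp] at h
    have hφ' (x y : M) : φ.Realize (Sum.elim p ![x, y]) ↔ R x y := hφ ![x, y]
    have hc {m : ℕ} (w : Fin m → M) (i j : Fin m) : w ∘ ![i, j] = ![w i, w j] := by
      funext l
      fin_cases l <;> rfl
    simp only [hc, Fin.snoc_last, Fin.snoc_castSucc, hφ'] at h
    exact h a ha

/-! ### Formulas whose meaning depends on the axioms -/

section

variable [Nonempty M] [SetModel M]

@[simp] theorem realize_isEmpty (x : Fin n) : (isEmpty x).Realize e v ↔ v x = empty := by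
  simp [isEmpty, eq_empty]

@[simp] theorem realize_isSucc (y x : Fin n) :
    (isSucc y x).Realize e v ↔ v y = succ (v x) := by
  simp [isSucc, eq_succ]

@[simp] theorem realize_isPow (y x : Fin n) : (isPow y x).Realize e v ↔ v y = pow (v x) := by
  simp [isPow, eq_pow]

@[simp] theorem realize_isUPair (p a b : Fin n) :
    (isUPair p a b).Realize e v ↔ v p = upair (v a) (v b) := by
  simp [isUPair, eq_upair]

@[simp] theorem realize_isPair (p a b : Fin n) :
    (isPair p a b).Realize e v ↔ v p = pair (v a) (v b) := by
  simp [isPair, pair]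

@[simp] theorem realize_isTriple (t a b c : Fin n) :
    (isTriple t a b c).Realize e v ↔ v t = triple (v a) (v b) (v c) := by
  simp [isTriple, triple]

@[simp] theorem realize_pairMem (r a b : Fin n) :
    (pairMem r a b).Realize e v ↔ pair (v a) (v b) ε v r := by
  simp [pairMem]

@[simp] theorem realize_tripleMem (r a b c : Fin n) :
    (tripleMem r a b c).Realize e v ↔ triple (v a) (v b) (v c) ε v r := by
  simp [tripleMem]

@[simp] theorem realize_isFunOn (f d : Fin n) :
    (isFunOn f d).Realize e v ↔ FunOn (v f) (v d) := by
  simp [isFunOn, FunOn]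

@[simp] theorem realize_isLimit (x : Fin n) : (isLimit x).Realize e v ↔ Limit (v x) := by
  simp [isLimit, Limit]

@[simp] theorem realize_isNat (x : Fin n) : (isNat x).Realize e v ↔ IsNat (v x) := by
  simp [isNat, IsNat]

@[simp] theorem realize_isFinite (x : Fin n) : (isFinite x).Realize e v ↔ IsFin (v x) := by
  simp [isFinite, IsFin]

theorem realize_isRec {step : ∀ {m : ℕ}, Fin m → Fin m → Fin m → Fml m} {Step : M → M → M → Prop}
    (h : ∀ {m : ℕ} (w : Fin m → M) (a b c : Fin m),
      (step a b c).Realize e w ↔ Step (w a) (w b) (w c)) (α y : Fin n) :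
    (isRec step α y).Realize e v ↔ RecRel Step (v α) (v y) := by
  simp [isRec, RecRel, Approx, h, and_assoc]

@[simp] theorem realize_isAddThree (y x : Fin n) :
    (isAddThree y x).Realize e v ↔ v y = addThree (v x) := by
  simp [isAddThree, addThree]

@[simp] theorem realize_isAddSix (y x : Fin n) :
    (isAddSix y x).Realize e v ↔ v y = addSix (v x) := by
  simp [isAddSix, addSix]

@[simp] theorem realize_isSixTimes (y α : Fin n) :
    (isSixTimes y α).Realize e v ↔ SetModel.Ord (v α) ∧ v y = six (v α) := by
  rw [isSixTimes, realize_isRec (Step := Graph fun _ u => addSix u) (by simp), recRel_iff, six]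

@[simp] theorem realize_isLevel (y α : Fin n) :
    (isLevel y α).Realize e v ↔ SetModel.Ord (v α) ∧ v y = V (v α) := by
  rw [isLevel, realize_isRec (Step := Graph fun _ u => pow u) (by simp), recRel_iff, V]

@[simp] theorem realize_isStr (A D R F : Fin n) :
    (isStr A D R F).Realize e v ↔ Str (v A) (v D) (v R) (v F) := by
  simp [isStr, Str]

@[simp] theorem realize_isNeutralExt (D R F D' R' F' x : Fin n) :
    (isNeutralExt D R F D' R' F' x).Realize e v ↔
      NeutralExt (v D) (v R) (v F) (v D') (v R') (v F') (v x) := by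
  simp [isNeutralExt, NeutralExt]

@[simp] theorem realize_isAdmissible (m W W' s D D' R' x w : Fin n) :
    (isAdmissible m W W' s D D' R' x w).Realize e v ↔
      Admissible (v m) (v W) (v W') (v s) (v D) (v D') (v R') (v x) (v w) := by
  simp [isAdmissible, Admissible]

theorem realize_isStep (α s s' : Fin n) : (isStep α s s').Realize e v ↔
    ∃ m m' W W', (SetModel.Ord (v α) ∧ m = six (v α)) ∧ m' = addSix m ∧
      (SetModel.Ord m ∧ W = V m) ∧ (SetModel.Ord m' ∧ W' = V m') ∧
      ∀ t, t ε v s' ↔ StepMem m W W' (v s) t := by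
  simp only [isStep, StepMem, StepCond, realize_all, realize_ex, realize_iff, realize_mem,
    realize_and, realize_or, realize_neg, realize_eq, Fin.snoc_last, Fin.snoc_castSucc,
    realize_isSixTimes, realize_isAddSix, realize_isLevel, realize_isTriple, realize_isAdmissible,
    realize_isImage, realize_tripleMem]
  refine exists_congr fun m => exists_congr fun m' => exists_congr fun W => exists_congr fun W' =>
    and_congr_right fun _ => and_congr_right fun _ => and_congr_right fun _ =>
    and_congr_right fun _ => forall_congr' fun t => iff_congr Iff.rfl <| exists_congr fun x =>
    exists_congr fun y => exists_congr fun z => and_congr_right fun _ => and_congr_right fun _ =>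
    and_congr_right fun _ => and_congr_right fun ht => ?_
  -- The formula says `t ∈ s`, while `StepCond` speaks of the triple that equals `t`.
  rw [ht]

/-- The hypothesis on `α` is needed because the formulas for `6α` and `V_{6α}` assert that their
arguments are ordinals. -/
theorem realize_isStep_iff (α s s' : Fin n) (hα : SetModel.Ord (v α)) :
    (isStep α s s').Realize e v ↔ v s' = nextS (v α) (v s) := by
  have hm (t : M) : t ε nextS (v α) (v s) ↔
      StepMem (six (v α)) (V (six (v α))) (V (addSix (six (v α)))) (v s) t := by
    rw [nextS, mem_sep]
    refine and_iff_right_of_imp ?_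
    rintro ⟨x, y, z, hx, hy, hz, rfl, -⟩
    exact triple_mem_V hα.six.addSix hx hy hz
  rw [realize_isStep]
  constructor
  · rintro ⟨m, m', W, W', ⟨-, rfl⟩, rfl, ⟨-, rfl⟩, ⟨-, rfl⟩, h⟩
    exact SetModel.ext _ _ fun t => by rw [h, hm]
  · intro h
    exact ⟨_, _, _, _, ⟨hα, rfl⟩, rfl, ⟨hα.six, rfl⟩, ⟨hα.six.addSix, rfl⟩, fun t => by rw [h, hm]⟩

/-- `isStep` is a family of formulas indexed by the number of variables. Its instance with three
variables gives a single step relation, which agrees with the graph of `nextS` at ordinals;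
`RecRel.congr` needs no more. -/
theorem realize_isRec_isStep (α s : Fin n) :
    (isRec isStep α s).Realize e v ↔ SetModel.Ord (v α) ∧ v s = levelS (v α) := by
  have h {m : ℕ} (w : Fin m → M) (a b c : Fin m) : (isStep a b c).Realize e w ↔
      (isStep (n := 3) 0 1 2).Realize e ![w a, w b, w c] := by
    simp [realize_isStep]
  rw [realize_isRec (Step := fun β u u' => (isStep (n := 3) 0 1 2).Realize e ![β, u, u']) h,
    RecRel.congr (Step' := Graph nextS)
      (fun β hβ u u' => realize_isStep_iff (v := ![β, u, u']) 0 1 2 (by simpa using hβ)),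
    recRel_iff, levelS]

theorem realize_ternary (a b c : Fin n) :
    (ternary a b c).Realize e v ↔ S (v a) (v b) (v c) := by
  simp [ternary, realize_isRec_isStep, S]

end

end SetFormula

/-! ### The definitional equivalence -/

section

variable {N : Type} [bothLang.Structure N]

theorem models_T₁_iff [memLang.Structure N]
    [LHom.IsExpansionOn (LHom.sumInl : memLang →ᴸ bothLang) N] :
    N ⊨ T₁ ↔ N ⊨ ZFMinusInfPlus ∧ ∀ xs : Fin 3 → N,
      Structure.RelMap (L := bothLang) (LHom.sumInr.onRelation ternarySymbol) xs ↔
        (SetFormula.ternary (n := 3) 0 1 2).Realize default xs := by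
  rw [T₁, Theory.model_union_iff, LHom.onTheory_model, Theory.model_singleton_iff,
    ternaryDefinition, Sentence.Realize, BoundedFormula.realize_alls]
  refine and_congr_right fun _ => forall_congr' fun xs => ?_
  rw [BoundedFormula.realize_iff, LHom.realize_onBoundedFormula, ternaryAtom,
    BoundedFormula.realize_rel]
  refine iff_congr (iff_of_eq (congrArg _ (funext fun i => ?_))) Iff.rfl
  fin_cases i <;> rfl

theorem relMap_mem_iff_forall_ternary [Nonempty N] (h : N ⊨ T₁) (x y : N) :
    Structure.RelMap (L := bothLang) (LHom.sumInl.onRelation memSymbol) ![x, y] ↔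
      ∀ z, Structure.RelMap (L := bothLang) (LHom.sumInr.onRelation ternarySymbol) ![x, y, z] := by
  let := (LHom.sumInl : memLang →ᴸ bothLang).reduct N
  obtain ⟨hZ, hS⟩ := models_T₁_iff.1 h
  have : SetModel N := SetFormula.setModel_of_models
  simp only [hS, SetFormula.realize_ternary]
  exact SetModel.mem_iff_forall_S (x := x) (y := y)

end

theorem T₁_models_mem_iff : T₁ ⊨ᵇ BoundedFormula.iff (memAtom (n := 2) 0 1)
    (BoundedFormula.all (ternaryAtom (n := 3) 0 1 2)) := by
  intro N e xs
  have h := relMap_mem_iff_forall_ternary N.is_model (xs 0) (xs 1)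
  rw [BoundedFormula.realize_iff, BoundedFormula.realize_all, memAtom, BoundedFormula.realize_rel]
  convert h using 1
  · refine iff_of_eq (congrArg _ (funext fun i => ?_))
    fin_cases i <;> rfl
  · refine forall_congr' fun z => ?_
    rw [ternaryAtom, BoundedFormula.realize_rel]
    refine iff_of_eq (congrArg _ (funext fun i => ?_))
    fin_cases i <;> rfl

/-- `T₀` consists of the consequences of `T₁` in its signature, so every reduct of a model of `T₁`
is a model of `T₀`. Membership is defined by `∀ z, S(x, y, z)`. -/
theorem isDefinitionalExtension_T₀ :
    IsDefinitionalExtension (LHom.sumInr : ternaryLang →ᴸ bothLang) T₀ T₁ where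
  injective := LHom.sumInr_injective
  conservative φ := by
    refine ⟨fun h => Theory.models_sentence_of_mem h, fun h => Theory.models_sentence_iff.2 ?_⟩
    intro N
    let := (LHom.sumInr : ternaryLang →ᴸ bothLang).reduct N
    have : N ⊨ T₀ := ⟨fun ψ hψ => (LHom.realize_onSentence N LHom.sumInr ψ).1
      (Theory.models_sentence_iff.1 hψ N)⟩
    exact (LHom.realize_onSentence N LHom.sumInr φ).2 (h.realize_sentence N)
  relation_def := by
    rintro _ (⟨⟨⟩⟩ | P)
    · refine ⟨BoundedFormula.all (Relations.boundedFormula ternarySymbol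
        ![Term.var (Sum.inl 0), Term.var (Sum.inl 1), Term.var (Sum.inr 0)]), fun N v xs => ?_⟩
      let := (LHom.sumInr : ternaryLang →ᴸ bothLang).reduct N
      have h := relMap_mem_iff_forall_ternary N.is_model (v 0) (v 1)
      rw [BoundedFormula.realize_iff, LHom.onFormula, LHom.realize_onBoundedFormula,
        BoundedFormula.realize_all]
      convert h using 1
      · refine BoundedFormula.realize_rel.trans (iff_of_eq (congrArg _ (funext fun i => ?_)))
        fin_cases i <;> rfl
      · refine forall_congr' fun z => ?_
        rw [BoundedFormula.realize_rel]
        refine iff_of_eq (congrArg _ (funext fun i => ?_))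
        fin_cases i <;> rfl
    · exact ⟨P.formula fun i => Term.var i, fun N v xs => BoundedFormula.realize_iff.2 Iff.rfl⟩
  function_def := by
    rintro _ (⟨⟨⟩⟩ | ⟨⟨⟩⟩)

theorem isDefinitionalExtension_ZFMinusInfPlus :
    IsDefinitionalExtension (LHom.sumInl : memLang →ᴸ bothLang) ZFMinusInfPlus T₁ where
  injective := LHom.sumInl_injective
  conservative φ := by
    refine ⟨fun h => Theory.models_sentence_iff.2 fun N => ?_,
      fun h => Theory.models_sentence_iff.2 fun N => ?_⟩
    · let : ternaryLang.Structure N :=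
        { funMap := fun f => f.elim
          RelMap := fun {n} P xs => match n, P, xs with
            | _, TernarySymbol.S, xs => (SetFormula.ternary (n := 3) 0 1 2).Realize default xs }
      have : N ⊨ T₁ := models_T₁_iff.2 ⟨N.is_model, fun xs => Iff.rfl⟩
      exact (LHom.realize_onSentence N LHom.sumInl φ).1 (h.realize_sentence N)
    · let := (LHom.sumInl : memLang →ᴸ bothLang).reduct N
      have : N ⊨ ZFMinusInfPlus := (models_T₁_iff.1 N.is_model).1
      exact (LHom.realize_onSentence N LHom.sumInl φ).2 (h.realize_sentence N)
  relation_def := by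
    rintro _ (P | ⟨⟨⟩⟩)
    · exact ⟨P.formula fun i => Term.var i, fun N v xs => BoundedFormula.realize_iff.2 Iff.rfl⟩
    -- The variables of `ternary` are indices of a bounded formula; `toFormula` makes them free, as
    -- a definition of `S` requires.
    · refine ⟨(SetFormula.ternary (n := 3) 0 1 2).toFormula.relabel (Sum.elim Empty.elim id),
        fun N v xs => ?_⟩
      let := (LHom.sumInl : memLang →ᴸ bothLang).reduct N
      have h := (models_T₁_iff.1 N.is_model).2 v
      obtain rfl : xs = default := Subsingleton.elim _ _
      rw [BoundedFormula.realize_iff, LHom.onFormula, LHom.realize_onBoundedFormula]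
      refine h.trans (Iff.symm ?_)
      refine Formula.realize_relabel.trans ((BoundedFormula.realize_toFormula _ _).trans ?_)
      exact iff_of_eq (congrArg₂ _ (Subsingleton.elim _ _) rfl)
  function_def := by
    rintro _ (⟨⟨⟩⟩ | ⟨⟨⟩⟩)

theorem mainTheorem2 :
    (T₁ ⊨ᵇ BoundedFormula.iff (memAtom (n := 2) 0 1)
      (BoundedFormula.all (ternaryAtom (n := 3) 0 1 2))) ∧
    DefinitionallyEquivalent T₀ ZFMinusInfPlus := by
  -- The sum of the signatures carries out the renaming: its two injections have disjoint images.
  refine ⟨T₁_models_mem_iff, bothLang, LHom.sumInr, LHom.sumInl, T₁, ?_, ?_,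
    isDefinitionalExtension_T₀, isDefinitionalExtension_ZFMinusInfPlus⟩
  · exact fun _ _ _ => Sum.inr_ne_inl
  · exact fun _ _ _ => Sum.inr_ne_inl
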